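/- Let $k,d\ge 1$ be integers, $T,t_0,M>0$, $\beta\in\,]0,2\wedge k[$, and let $\sigma=(\sigma_{i,j})$ be a deterministic invertible $d\times d$ matrix. Write $\mathcal F f(\xi)=\int_{\mathbb R^k} e^{-i\xi\cdot x}f(x)\,dx$ for the Fourier transform, let $\Gamma$ be a non-negative tempered measure on $\mathbb R^k$ with $\Gamma=\mathcal F\mu$, and assume $(\mathrm H_\beta)$: the spectral measure $\mu$ is absolutely continuous with respect to Lebesgue measure with density $\|\xi\|^{-k+\beta}$. Let $F=(F^1,\dots,F^d)$ be a centered Gaussian family indexed by $C_0^\infty(\mathbb R^{k+1})$ with covariance $$E\bigl(F^i(\varphi)F^j(\psi)\bigr)=\delta_{i,j}\int_{\mathbb R_+}dr\int_{\mathbb R^k}\Gamma(dx)\,\bigl(\varphi(r,\cdot)*\tilde\psi(r,\cdot)\bigr)(x),\qquad \tilde\psi(r,x)=\psi(r,-x).$$ Let $G$ be the fundamental solution of the wave equation on $\mathbb R^k$, that is, the family of tempered distributions with $\mathcal F G(t)(\xi)=\sin(t\|\xi\|)/\|\xi\|$, and let $u=(u_1,\dots,u_d)$ be the solution of the system $\frac{\partial^2u_i}{\partial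 t^2}-\Delta u_i=\sum_{j=1}^d\sigma_{i,j}\dot F^j$ on $]0,T]\times\mathbb R^k$ with vanishing initial conditions, that is, $$u_i(t,x)=\sum_{j=1}^d\sigma_{i,j}\int_0^t\int_{\mathbb R^k}G(t-r,x-y)\,M^j(dr,dy)\quad\text{a.s.},\qquad (t,x)\in[0,T]\times\mathbb R^k,$$ where the stochastic integral of a deterministic distribution-valued integrand $S$ with respect to the martingale measure $M^j$ of $F^j$ is the $L^2(P)$-limit of $F^j(\varphi_n)$ for test functions $\varphi_n$ with $\int_{\mathbb R_+}dr\int_{\mathbb R^k}\mu(d\xi)\,|\mathcal F\varphi_n(r,\cdot)(\xi)-\mathcal FS(r)(\xi)|^2\to0$. Then there exist positive constants $C_1,C_2$, depending only on $k,d,\beta,\sigma,t_0,T,M$, such that for all $(t,x),(s,y)\in[t_0,T]\times[-M,M]^k$, the variable $\|u(t,x)-u(s,y)\|^2$ is integrable and $$C_1\bigl(|t-s|+\|x-y\|\bigr)^{2-\beta}\le E\bigl(\|u(t,x)-u(s,y)\|^2\bigr)\le C_2\bigl(|t-s|+\|x-y\|\bigr)^{2-\beta}.$$ Consequently the canonical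 metric $\delta((t,x),(s,y))=\bigl(E\|u(t,x)-u(s,y)\|^2\bigr)^{1/2}$ satisfies $$\sqrt{C_1}\,\bigl(|t-s|+\|x-y\|\bigr)^{(2-\beta)/2}\le\delta((t,x),(s,y))\le\sqrt{C_2}\,\bigl(|t-s|+\|x-y\|\bigr)^{(2-\beta)/2}.$$ -/

import Mathlib

open MeasureTheory ProbabilityTheory Filter Set
open scoped SchwartzMap FourierTransform Laplacian ENNReal Topology Distributions RealInnerProductSpace

noncomputable section

namespace StochWave

/-- `ℝ^k` with the Euclidean norm. -/
abbrev Space (k : ℕ) : Type := EuclideanSpace ℝ (Fin k)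

/-- The space `C_0^∞(ℝ^{k+1})` of smooth real functions of `(r, y) ∈ ℝ × ℝ^k` with compact
support. -/
abbrev Test (k : ℕ) : Type := 𝓓((⊤ : TopologicalSpace.Opens (ℝ × Space k)), ℝ)

/-! ### Fourier transforms, without the factor `2π` in the exponent -/

/-- The Fourier transform `𝓕 f (ξ) = ∫ exp (-i ξ·x) f(x) dx` of an integrable function. -/
def fourier {k : ℕ} (f : Space k → ℂ) (ξ : Space k) : ℂ :=
  ∫ x, Complex.exp (-((⟪ξ, x⟫ : ℝ) : ℂ) * Complex.I) * f x

/-- The dilation of `ℝ^k` by a nonzero factor. -/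
def dilation (k : ℕ) (c : ℝ) (hc : c ≠ 0) : Space k ≃L[ℝ] Space k :=
  ContinuousLinearEquiv.smulLeft (Units.mk0 c hc)

/-- The Fourier transform of a Schwartz function, as a Schwartz function; see
`fourierSchwartz_apply`. -/
def fourierSchwartz {k : ℕ} (ψ : 𝓢(Space k, ℂ)) : 𝓢(Space k, ℂ) :=
  SchwartzMap.compCLMOfContinuousLinearEquiv ℂ
    (dilation k (2 * Real.pi)⁻¹ (inv_ne_zero Real.two_pi_pos.ne')) (𝓕 ψ)

theorem fourierSchwartz_apply {k : ℕ} (ψ : 𝓢(Space k, ℂ)) (ξ : Space k) :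
    fourierSchwartz ψ ξ = fourier ψ ξ := by
  have h : fourierSchwartz ψ ξ = (𝓕 ψ : 𝓢(Space k, ℂ)) ((2 * Real.pi)⁻¹ • ξ) := rfl
  rw [h, SchwartzMap.fourier_coe, Real.fourier_eq', fourier]
  refine integral_congr_ae (Eventually.of_forall fun x => ?_)
  simp only [smul_eq_mul, inner_smul_right, real_inner_comm x ξ]
  congr 2
  have : (-2 * Real.pi * ((2 * Real.pi)⁻¹ * ⟪x, ξ⟫) : ℝ) = -⟪x, ξ⟫ := by
    field_simp
  rw [this]
  push_cast
  rfl

/-- The Fourier transform of the tempered distribution `S` is the locally integrable function `h`: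
`⟨S, 𝓕 ψ⟩ = ∫ h ψ` for all Schwartz functions `ψ`. -/
structure HasFourierTransform {k : ℕ} (S : 𝓢'(Space k, ℂ)) (h : Space k → ℂ) : Prop where
  locallyIntegrable : LocallyIntegrable h
  integrable : ∀ ψ : 𝓢(Space k, ℂ), Integrable fun ξ => h ξ * ψ ξ
  eq_integral : ∀ ψ : 𝓢(Space k, ℂ), S (fourierSchwartz ψ) = ∫ ξ, h ξ * ψ ξ

/-! ### The fundamental solution of the wave equation -/

/-- The bounded continuous function `η ↦ sin (2π t ‖η‖) / (2π ‖η‖)`, with value `t` at `0`. -/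
def waveSymbol {k : ℕ} (t : ℝ) (η : Space k) : ℂ :=
  ((t * Real.sinc (2 * Real.pi * t * ‖η‖) : ℝ) : ℂ)

theorem continuous_waveSymbol {k : ℕ} (t : ℝ) : Continuous (waveSymbol (k := k) t) := by
  have := Real.continuous_sinc
  unfold waveSymbol
  fun_prop

theorem norm_waveSymbol_le {k : ℕ} (t : ℝ) (η : Space k) : ‖waveSymbol t η‖ ≤ |t| := by
  rw [waveSymbol, Complex.norm_real, Real.norm_eq_abs, abs_mul]
  exact mul_le_of_le_one_right (abs_nonneg t) (Real.abs_sinc_le_one _)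

theorem memLp_waveSymbol {k : ℕ} (t : ℝ) :
    MemLp (waveSymbol (k := k) t) ∞ (volume : Measure (Space k)) :=
  memLp_top_of_bound (continuous_waveSymbol t).aestronglyMeasurable |t|
    (Eventually.of_forall (norm_waveSymbol_le t))

/-- The fundamental solution `G(t)` of the wave equation on `ℝ^k`, for every dimension `k`: the
tempered distribution whose Fourier transform is `sin (t ‖ξ‖) / ‖ξ‖`. (The inverse transform `𝓕⁻`
below is Mathlib's, which has `2π` in the exponent, whence `waveSymbol`.) That this is the
fundamental solution is proved in `isWaveFundamentalSolution_waveKernel`. -/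
def waveKernel (k : ℕ) (t : ℝ) : 𝓢'(Space k, ℂ) :=
  𝓕⁻ (Lp.toTemperedDistribution (memLp_waveSymbol (k := k) t).toLp)

/-- `G` solves `∂²G/∂t² = Δ G` in the sense of tempered distributions, with `G(0) = 0` and
`∂G/∂t (0) = δ₀`. -/
def IsWaveFundamentalSolution {k : ℕ} (G : ℝ → 𝓢'(Space k, ℂ)) : Prop :=
  ∃ G' : ℝ → 𝓢'(Space k, ℂ),
    G 0 = 0 ∧ G' 0 = TemperedDistribution.delta 0 ∧
    ∀ (φ : 𝓢(Space k, ℂ)) (t : ℝ),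
      HasDerivAt (fun r => G r φ) (G' t φ) t ∧
      HasDerivAt (fun r => G' r φ) ((Δ (G t)) φ) t

/-- The function `η ↦ cos (2π t ‖η‖)`. -/
def cosSymbol {k : ℕ} (t : ℝ) (η : Space k) : ℂ :=
  ((Real.cos (2 * Real.pi * t * ‖η‖) : ℝ) : ℂ)

theorem memLp_cosSymbol {k : ℕ} (t : ℝ) :
    MemLp (cosSymbol (k := k) t) ∞ (volume : Measure (Space k)) := by
  refine memLp_top_of_bound (Continuous.aestronglyMeasurable ?_) 1 (Eventually.of_forall fun η => ?_)
  · unfold cosSymbol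
    fun_prop
  · rw [cosSymbol, Complex.norm_real, Real.norm_eq_abs]
    exact Real.abs_cos_le_one _

theorem waveKernel_apply {k : ℕ} (t : ℝ) (φ : 𝓢(Space k, ℂ)) :
    waveKernel k t φ = ∫ η, (𝓕⁻ φ : 𝓢(Space k, ℂ)) η * waveSymbol t η := by
  rw [waveKernel, TemperedDistribution.fourierInv_apply, Lp.toTemperedDistribution_apply]
  refine integral_congr_ae ?_
  filter_upwards [(memLp_waveSymbol (k := k) t).coeFn_toLp] with η hη
  rw [hη, smul_eq_mul]

theorem hasDerivAt_mul_sinc (a t : ℝ) :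
    HasDerivAt (fun r : ℝ => r * Real.sinc (a * r)) (Real.cos (a * t)) t := by
  by_cases ha : a = 0
  · subst ha
    simp only [zero_mul, Real.sinc_zero, mul_one, Real.cos_zero]
    exact hasDerivAt_id' t
  · have h : (fun r : ℝ => r * Real.sinc (a * r)) = fun r => Real.sin (a * r) / a := by
      funext r
      by_cases hr : r = 0
      · simp [hr]
      · rw [Real.sinc_of_ne_zero (mul_ne_zero ha hr)]
        field_simp
    rw [h]
    have h2 : HasDerivAt (fun r : ℝ => a * r) a t := by simpa using (hasDerivAt_id t).const_mul a
    have := (h2.sin).div_const a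
    rwa [mul_div_cancel_right₀ _ ha] at this

theorem hasDerivAt_waveSymbol {k : ℕ} (t : ℝ) (η : Space k) :
    HasDerivAt (fun r => waveSymbol r η) (cosSymbol t η) t := by
  have h := (hasDerivAt_mul_sinc (2 * Real.pi * ‖η‖) t).ofReal_comp
  unfold waveSymbol cosSymbol
  have e : ∀ r : ℝ, 2 * Real.pi * r * ‖η‖ = 2 * Real.pi * ‖η‖ * r := fun r => by ring
  simp only [e]
  exact h

theorem hasDerivAt_cosSymbol {k : ℕ} (t : ℝ) (η : Space k) :
    HasDerivAt (fun r => cosSymbol r η)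
      (-(((2 * Real.pi * ‖η‖) ^ 2 : ℝ) : ℂ) * waveSymbol t η) t := by
  have h2 : HasDerivAt (fun r : ℝ => 2 * Real.pi * r * ‖η‖) (2 * Real.pi * ‖η‖) t := by
    simpa using ((hasDerivAt_id t).const_mul (2 * Real.pi)).mul_const ‖η‖
  have h := (h2.cos).ofReal_comp
  have key : -Real.sin (2 * Real.pi * t * ‖η‖) * (2 * Real.pi * ‖η‖) =
      -(2 * Real.pi * ‖η‖) ^ 2 * (t * Real.sinc (2 * Real.pi * t * ‖η‖)) := by
    by_cases h0 : 2 * Real.pi * t * ‖η‖ = 0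
    · rw [h0]
      have : t * (2 * Real.pi * ‖η‖) = 0 := by linarith
      simp only [Real.sin_zero, Real.sinc_zero]
      linear_combination (2 * Real.pi * ‖η‖) * this
    · rw [Real.sinc_of_ne_zero h0]
      have : t ≠ 0 := by rintro rfl; simp at h0
      have : ‖η‖ ≠ 0 := by intro h; simp [h] at h0
      field_simp
  unfold cosSymbol waveSymbol
  rw [key] at h
  convert h using 1
  push_cast
  ring

theorem norm_waveSymbol_mul_le {k : ℕ} (t : ℝ) (η : Space k) :
    ‖-(((2 * Real.pi * ‖η‖) ^ 2 : ℝ) : ℂ) * waveSymbol t η‖ ≤ (2 * Real.pi) ^ 2 * ‖η‖ ^ 2 * |t| := by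
  rw [norm_mul, norm_neg, Complex.norm_real, Real.norm_eq_abs, abs_of_nonneg (by positivity),
    mul_pow]
  exact mul_le_mul_of_nonneg_left (norm_waveSymbol_le t η) (by positivity)

theorem fourierInv_laplacian {k : ℕ} (φ : 𝓢(Space k, ℂ)) (η : Space k) :
    (𝓕⁻ (Δ φ) : 𝓢(Space k, ℂ)) η =
      -(((2 * Real.pi * ‖η‖) ^ 2 : ℝ) : ℂ) * (𝓕⁻ φ : 𝓢(Space k, ℂ)) η := by
  have hg : (fun x : Space k => ‖x‖ ^ 2).HasTemperateGrowth := by fun_prop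
  have hf : (𝓕 (Δ φ) : 𝓢(Space k, ℂ)) (-η) =
      -(((2 * Real.pi * ‖η‖) ^ 2 : ℝ) : ℂ) * (𝓕 φ : 𝓢(Space k, ℂ)) (-η) := by
    rw [SchwartzMap.laplacian_eq_fourierMultiplierCLM, FourierTransform.fourier_smul,
      SchwartzMap.fourierMultiplierCLM_apply, FourierTransform.fourier_fourierInv_eq,
      smul_apply]
    have := SchwartzMap.smulLeftCLM_apply_apply (F := ℂ) hg (𝓕 φ) (-η)
    erw [this]
    simp [mul_pow]
    ring
  simpa [SchwartzMap.fourierInv_apply_eq] using hf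

theorem isWaveFundamentalSolution_waveKernel (k : ℕ) :
    IsWaveFundamentalSolution (waveKernel k) := by
  have hG' : ∀ (t : ℝ) (φ : 𝓢(Space k, ℂ)),
      (𝓕⁻ (Lp.toTemperedDistribution (memLp_cosSymbol (k := k) t).toLp) : 𝓢'(Space k, ℂ)) φ =
        ∫ η, (𝓕⁻ φ : 𝓢(Space k, ℂ)) η * cosSymbol t η := by
    intro t φ
    rw [TemperedDistribution.fourierInv_apply, Lp.toTemperedDistribution_apply]
    refine integral_congr_ae ?_
    filter_upwards [(memLp_cosSymbol (k := k) t).coeFn_toLp] with η hη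
    rw [hη, smul_eq_mul]
  refine ⟨fun t => 𝓕⁻ (Lp.toTemperedDistribution (memLp_cosSymbol (k := k) t).toLp), ?_, ?_, ?_⟩
  · ext φ
    simp [waveKernel_apply, waveSymbol]
  · ext φ
    rw [hG']
    have h : φ = 𝓕 (𝓕⁻ φ) := (FourierTransform.fourier_fourierInv_eq φ).symm
    conv_rhs => rw [h]
    rw [TemperedDistribution.delta_apply, SchwartzMap.fourier_coe, Real.fourier_eq']
    simp [cosSymbol]
  · intro φ t
    set g : 𝓢(Space k, ℂ) := 𝓕⁻ φ with hgdef
    have hcont : ∀ r, Continuous (cosSymbol (k := k) r) := fun r => by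
      unfold cosSymbol
      fun_prop
    constructor
    · simp only [waveKernel_apply, hG']
      refine (hasDerivAt_integral_of_dominated_loc_of_deriv_le (s := univ) univ_mem
        (F := fun r η => g η * waveSymbol r η) (F' := fun r η => g η * cosSymbol r η)
        (μ := (volume : Measure (Space k))) (x₀ := t)
        (bound := fun η => ‖g η‖) (Eventually.of_forall fun r => ?_) ?_ ?_ ?_ ?_ ?_).2
      · exact (g.continuous.mul (continuous_waveSymbol r)).aestronglyMeasurable
      · refine (g.integrable.norm.mul_const |t|).mono'
          (g.continuous.mul (continuous_waveSymbol t)).aestronglyMeasurable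
          (Eventually.of_forall fun η => ?_)
        rw [norm_mul]
        exact mul_le_mul_of_nonneg_left (norm_waveSymbol_le t η) (norm_nonneg _)
      · exact (g.continuous.mul (hcont t)).aestronglyMeasurable
      · refine Eventually.of_forall fun η r _ => ?_
        rw [norm_mul, cosSymbol, Complex.norm_real, Real.norm_eq_abs]
        exact mul_le_of_le_one_right (norm_nonneg _) (Real.abs_cos_le_one _)
      · exact g.integrable.norm
      · exact Eventually.of_forall fun η r _ => (hasDerivAt_waveSymbol r η).const_mul (g η)
    · rw [TemperedDistribution.laplacian_apply_apply, waveKernel_apply]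
      simp only [hG', fourierInv_laplacian, ← hgdef]
      have hint : Integrable fun η : Space k => (2 * Real.pi) ^ 2 * (‖η‖ ^ 2 * ‖g η‖) * (|t| + 1) :=
        ((g.integrable_pow_mul volume 2).const_mul _).mul_const _
      have hd := (hasDerivAt_integral_of_dominated_loc_of_deriv_le (s := Metric.ball t 1)
        (F := fun r η => g η * cosSymbol r η)
        (F' := fun r η => g η * (-(((2 * Real.pi * ‖η‖) ^ 2 : ℝ) : ℂ) * waveSymbol r η))
        (μ := (volume : Measure (Space k))) (x₀ := t)
        (Metric.ball_mem_nhds t one_pos)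
        (bound := fun η => (2 * Real.pi) ^ 2 * (‖η‖ ^ 2 * ‖g η‖) * (|t| + 1))
        (Eventually.of_forall fun r => (g.continuous.mul (hcont r)).aestronglyMeasurable)
        ?_ ?_ ?_ hint ?_).2
      · have e : ∫ η, -(((2 * Real.pi * ‖η‖) ^ 2 : ℝ) : ℂ) * g η * waveSymbol t η =
            ∫ η, g η * (-(((2 * Real.pi * ‖η‖) ^ 2 : ℝ) : ℂ) * waveSymbol t η) :=
          integral_congr_ae (Eventually.of_forall fun η => by ring)
        rw [e]
        exact hd
      · refine g.integrable.norm.mono' (g.continuous.mul (hcont t)).aestronglyMeasurable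
          (Eventually.of_forall fun η => ?_)
        rw [norm_mul, cosSymbol, Complex.norm_real, Real.norm_eq_abs]
        exact mul_le_of_le_one_right (norm_nonneg _) (Real.abs_cos_le_one _)
      · have := continuous_waveSymbol (k := k) t
        have := g.continuous
        exact Continuous.aestronglyMeasurable (by fun_prop)
      · refine Eventually.of_forall fun η r hr => ?_
        have hr' : |r| ≤ |t| + 1 := by
          have h1 : |r - t| < 1 := by simpa [Real.dist_eq] using hr
          have h2 := abs_sub_abs_le_abs_sub r t
          linarith
        rw [norm_mul]
        calc ‖g η‖ * _ ≤ ‖g η‖ * ((2 * Real.pi) ^ 2 * ‖η‖ ^ 2 * |r|) :=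
              mul_le_mul_of_nonneg_left (norm_waveSymbol_mul_le r η) (norm_nonneg _)
          _ ≤ ‖g η‖ * ((2 * Real.pi) ^ 2 * ‖η‖ ^ 2 * (|t| + 1)) := by gcongr
          _ = _ := by ring
      · exact Eventually.of_forall fun η r _ => (hasDerivAt_cosSymbol r η).const_mul (g η)

/-- The distribution `S(x - ·)`, that is `φ ↦ ⟨S, φ(x - ·)⟩`. -/
def reflectTranslate {k : ℕ} (x : Space k) (S : 𝓢'(Space k, ℂ)) : 𝓢'(Space k, ℂ) :=
  PointwiseConvergenceCLM.precomp ℂ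
    (SchwartzMap.compCLMOfContinuousLinearEquiv ℂ (ContinuousLinearEquiv.neg ℝ (M := Space k)) ∘L
      SchwartzMap.compSubConstCLM ℂ (-x)) S

theorem reflectTranslate_apply {k : ℕ} (x : Space k) (S : 𝓢'(Space k, ℂ))
    (φ ψ : 𝓢(Space k, ℂ)) (h : ∀ z, ψ z = φ (x - z)) : reflectTranslate x S φ = S ψ := by
  have : (SchwartzMap.compCLMOfContinuousLinearEquiv ℂ
      (ContinuousLinearEquiv.neg ℝ (M := Space k))
      (SchwartzMap.compSubConstCLM ℂ (-x) φ)) = ψ := by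
    ext z
    rw [h]
    simp [sub_eq_add_neg, add_comm]
  rw [← this]
  rfl

/-! ### The noise and its stochastic integral -/

/-- `μ` is the spectral measure of the covariance measure `Γ`: both are tempered and `Γ = 𝓕 μ`,
that is `∫ ψ dΓ = ∫ 𝓕 ψ dμ` for all Schwartz functions `ψ`. (This makes `Γ` non-negative
definite.) -/
structure IsSpectralMeasure {k : ℕ} (Γ μ : Measure (Space k)) : Prop where
  temperedCovariance : Γ.HasTemperateGrowth
  temperedSpectral : μ.HasTemperateGrowth
  eq_fourier : ∀ ψ : 𝓢(Space k, ℂ), ∫ x, ψ x ∂Γ = ∫ ξ, fourier ψ ξ ∂μ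

/-- The spectral measure is absolutely continuous with density `‖ξ‖^(-k+β)`, where
`β ∈ ]0, 2 ∧ k[`. -/
structure HypBeta {k : ℕ} (μ : Measure (Space k)) (β : ℝ) : Prop where
  pos : 0 < β
  lt_two : β < 2
  lt_dim : β < k
  eq_withDensity :
    μ = volume.withDensity fun ξ => ENNReal.ofReal (‖ξ‖ ^ (-(k : ℝ) + β))

variable {Ω : Type*} [MeasurableSpace Ω]

/-- `F = (F¹, …, F^d)` is a centered Gaussian family, indexed by `C_0^∞(ℝ^{k+1})`, with covariance
`E (Fⁱ(φ) Fʲ(ψ)) = δ_{ij} ∫_{ℝ₊} dr ∫ Γ(dx) (φ(r,·) * ψ~(r,·))(x)`, where `ψ~(r,x) = ψ(r,-x)`: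
noise that is white in time and spatially homogeneous with covariance measure `Γ`. -/
structure IsHomogeneousNoise {k d : ℕ} (P : Measure Ω) (Γ : Measure (Space k))
    (F : Fin d → Test k → Ω → ℝ) : Prop where
  gaussian : IsGaussianProcess (fun p : Fin d × Test k => F p.1 p.2) P
  centered : ∀ i φ, ∫ ω, F i φ ω ∂P = 0
  covariance : ∀ i j φ ψ, ∫ ω, F i φ ω * F j ψ ω ∂P =
    if i = j then
      ∫ r in Ioi (0 : ℝ), ∫ x, convolution (fun y => φ (r, y)) (fun y => ψ (r, -y))
        (ContinuousLinearMap.mul ℝ ℝ) volume x ∂Γ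
    else 0

/-- `X` is the stochastic integral `∫_{ℝ₊} ∫ S(r,y) M(dr,dy)` of the deterministic,
distribution-valued integrand `r ↦ S r` with respect to the martingale measure `M` of the (scalar)
noise `F` with spectral measure `μ`: it is the value at `S` of the isometric extension of
`φ ↦ F(φ)` for the norm `‖S‖² = ∫_{ℝ₊} dr ∫ μ(dξ) |𝓕 S(r)(ξ)|²`. In other words, `X` is the limit
in `L²(P)` of `F(φ_n)` for test functions `φ_n` that converge to `S` in this norm. (The transform
`h r` of `S r` is determined Lebesgue-almost everywhere; this is used for `μ` absolutely
continuous.) -/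
def IsStochasticIntegral {k : ℕ} (P : Measure Ω) (μ : Measure (Space k)) (F : Test k → Ω → ℝ)
    (S : ℝ → 𝓢'(Space k, ℂ)) (X : Ω → ℝ) : Prop :=
  MemLp X 2 P ∧
  ∃ (h : ℝ → Space k → ℂ) (φ : ℕ → Test k),
    (∀ r, 0 < r → HasFourierTransform (S r) (h r)) ∧
    Tendsto (fun n => ∫⁻ r in Ioi (0 : ℝ), ∫⁻ ξ,
      ‖fourier (fun y => (φ n (r, y) : ℂ)) ξ - h r ξ‖ₑ ^ 2 ∂μ) atTop (𝓝 0) ∧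
    Tendsto (fun n => eLpNorm (fun ω => F (φ n) ω - X ω) 2 P) atTop (𝓝 0)

/-- The integrand `(r, y) ↦ 1_{[0,t]}(r) G(t - r, x - y)`. -/
def waveIntegrand {k : ℕ} (t : ℝ) (x : Space k) (r : ℝ) : 𝓢'(Space k, ℂ) :=
  if r ∈ Icc 0 t then reflectTranslate x (waveKernel k (t - r)) else 0

/-- `u` is the solution on `[0,T] × ℝ^k` of the system
`∂²uᵢ/∂t² - Δ uᵢ = ∑ⱼ σᵢⱼ Ḟʲ` with vanishing initial conditions:
`uᵢ(t,x) = ∑ⱼ σᵢⱼ ∫₀ᵗ ∫ G(t-r,x-y) Mʲ(dr,dy)` almost surely, for every `(t,x)`. -/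
def IsWaveSolution {k d : ℕ} (P : Measure Ω) (μ : Measure (Space k))
    (F : Fin d → Test k → Ω → ℝ) (σ : Matrix (Fin d) (Fin d) ℝ) (T : ℝ)
    (u : ℝ → Space k → Ω → EuclideanSpace ℝ (Fin d)) : Prop :=
  ∀ t ∈ Icc 0 T, ∀ x : Space k, ∃ v : Fin d → Ω → ℝ,
    (∀ j, IsStochasticIntegral P μ (F j) (waveIntegrand t x) (v j)) ∧
    ∀ᵐ ω ∂P, ∀ i, u t x ω i = ∑ j, σ i j * v j ω

/-- The canonical (pseudo-)metric `δ((t,x),(s,y)) = (E ‖u(t,x) - u(s,y)‖²)^{1/2}`. -/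
def canonicalMetric {k d : ℕ} (P : Measure Ω)
    (u : ℝ → Space k → Ω → EuclideanSpace ℝ (Fin d)) (t : ℝ) (x : Space k) (s : ℝ)
    (y : Space k) : ℝ :=
  Real.sqrt (∫ ω, ‖u t x ω - u s y ω‖ ^ 2 ∂P)

end StochWave

end

/-!
In Fourier variables the integrand of `u(t,x)` is
`H_{t,x}(r,ξ) = exp (-i ξ·x) sin ((t - r)⁺ ‖ξ‖) / ‖ξ‖` (`waveMultiplier`), and the stochastic
integral is isometric for the `L²` norm of `dr μ(dξ)`, with independent noises giving orthogonal integrals.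
Hence `E ‖u(t,x) - u(s,y)‖² = (∑ σᵢⱼ²) ‖H_{t,x} - H_{s,y}‖²`
(`IsWaveSolution.integral_norm_sub_sq`), and the theorem is a statement on this deterministic norm.
Only the covariance of `F` enters, through Parseval's identity for `Γ = 𝓕 μ`
(`IsSpectralMeasure.integral_convolution_slice`). Put `ρ = |t - s| + ‖x - y‖`.

*Upper bound.* The complex exponential and the sine are bounded and Lipschitz, so
`|H_{t,x} - H_{s,y}| ≤ min (2, ρ ‖ξ‖) / ‖ξ‖`. The substitution `η = ρ ξ` turns the integral of the
square against `‖ξ‖^(-k+β) dξ` into `ρ^(2-β)` times a constant, which is finite because `0 < β < 2`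
(`HypBeta.lintegral_increment_le`).

*Lower bound.* If `[0, t₀]` contains a half period of `sin (‖ξ‖ r)`, the integral of
`‖ξ‖² |H_{t,x} - H_{s,y}|²` over a whole number of half periods in `[0, t₀]` is exactly their total
length times `1 - cos (ξ·(x - y)) cos (‖ξ‖ (t - s))`; this is at least `t₀ / 2` times the latter
factor (`lintegral_time_ge`). Since `ρ` is bounded on the given region, one annulus
`Q ≤ ‖η‖ ≤ 2 Q`, rescaled by `ξ = η / ρ`, satisfies the requirement for all `ρ`. It contributes
`ρ^(2-β)` times the value at `((t - s) / ρ, (x - y) / ρ)` of a continuous function that is positive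
away from the origin (`bandVariogram`), hence bounded below on the unit sphere
(`exists_le_bandVariogram`).
-/

namespace StochWave

/-! ### The Fourier transform of the wave kernel -/

/-- The Fourier transform of `y ↦ 1_{r ≤ t} G(t - r, x - y)`. The positive part of `t - r` encodes
the indicator, and `τ sinc (τ ‖ξ‖)` is `sin (τ ‖ξ‖) / ‖ξ‖`, with value `τ` at `ξ = 0`. -/
noncomputable def waveMultiplier {k : ℕ} (t : ℝ) (x : Space k) (r : ℝ) (ξ : Space k) : ℂ :=
  Complex.exp (-((⟪ξ, x⟫ : ℝ) : ℂ) * Complex.I) *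
    ((max (t - r) 0 * Real.sinc (max (t - r) 0 * ‖ξ‖) : ℝ) : ℂ)

theorem continuous_uncurry_waveMultiplier {k : ℕ} (t : ℝ) (x : Space k) :
    Continuous (Function.uncurry (waveMultiplier t x)) := by
  have := Real.continuous_sinc
  unfold waveMultiplier Function.uncurry
  fun_prop

theorem continuous_waveMultiplier {k : ℕ} (t : ℝ) (x : Space k) (r : ℝ) :
    Continuous (waveMultiplier t x r) := by
  have := Real.continuous_sinc
  unfold waveMultiplier
  fun_prop

theorem continuous_waveMultiplier_time {k : ℕ} (t : ℝ) (x : Space k) (ξ : Space k) :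
    Continuous fun r => waveMultiplier t x r ξ := by
  have := Real.continuous_sinc
  unfold waveMultiplier
  fun_prop

theorem waveMultiplier_of_le {k : ℕ} {t r : ℝ} (h : t ≤ r) (x ξ : Space k) :
    waveMultiplier t x r ξ = 0 := by
  simp [waveMultiplier, max_eq_right (sub_nonpos.2 h)]

/-- Fourier inversion: the inverse transform of `z ↦ 𝓕 ψ (x - z)` is a modulated dilation of
`ψ`. -/
theorem fourierInv_fourierSchwartz_sub {k : ℕ} (x : Space k) (ψ χ : 𝓢(Space k, ℂ))
    (h : ∀ z, χ z = fourierSchwartz ψ (x - z)) (η : Space k) :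
    (𝓕⁻ χ : 𝓢(Space k, ℂ)) η =
      ((2 * Real.pi) ^ k : ℝ) • (Complex.exp ((2 * Real.pi * ⟪η, x⟫ : ℝ) * Complex.I) *
        ψ (-(2 * Real.pi) • η)) := by
  have hpi : (2 * Real.pi) ≠ 0 := Real.two_pi_pos.ne'
  have e1 : (𝓕⁻ χ : 𝓢(Space k, ℂ)) η =
      ∫ z, Complex.exp ((2 * Real.pi * ⟪z, η⟫ : ℝ) * Complex.I) * χ z := by
    rw [SchwartzMap.fourierInv_coe, Real.fourierInv_eq']
    rfl
  have e2 : ψ (-(2 * Real.pi) • η) =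
      ∫ w, Complex.exp ((2 * Real.pi * ⟪w, -(2 * Real.pi) • η⟫ : ℝ) * Complex.I) *
        (𝓕 ψ : 𝓢(Space k, ℂ)) w := by
    conv_lhs => rw [← FourierTransform.fourierInv_fourier_eq (F := 𝓢(Space k, ℂ)) ψ]
    rw [SchwartzMap.fourierInv_coe, Real.fourierInv_eq']
    rfl
  set f : Space k → ℂ := fun w =>
    Complex.exp ((2 * Real.pi * ⟪w, -(2 * Real.pi) • η⟫ : ℝ) * Complex.I) *
        (𝓕 ψ : 𝓢(Space k, ℂ)) w with hf
  have e3 := Measure.integral_comp_smul (volume : Measure (Space k)) f ((2 * Real.pi)⁻¹)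
  have e4 : ∫ z, Complex.exp ((2 * Real.pi * ⟪z, η⟫ : ℝ) * Complex.I) * χ z =
      ∫ z, Complex.exp ((2 * Real.pi * ⟪η, x⟫ : ℝ) * Complex.I) * f ((2 * Real.pi)⁻¹ • z) := by
    rw [← integral_sub_left_eq_self _ volume x]
    refine integral_congr_ae (Eventually.of_forall fun z => ?_)
    have : χ (x - z) = (𝓕 ψ : 𝓢(Space k, ℂ)) ((2 * Real.pi)⁻¹ • z) := by
      rw [h, sub_sub_cancel]; rfl
    simp only [this, hf, ← mul_assoc, ← Complex.exp_add]
    congr 2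
    rw [← add_mul, ← Complex.ofReal_add]
    congr 2
    simp only [inner_smul_left, inner_smul_right, inner_sub_left, real_inner_comm x η]
    simp only [conj_trivial]
    field_simp
    ring
  rw [e1, e4, integral_const_mul, e3, e2, mul_smul_comm]
  congr 1
  rw [finrank_euclideanSpace_fin, abs_of_pos (by positivity), inv_pow, inv_inv]

theorem reflectTranslate_waveKernel_fourierSchwartz {k : ℕ} (t : ℝ) (x : Space k)
    (ψ : 𝓢(Space k, ℂ)) :
    reflectTranslate x (waveKernel k t) (fourierSchwartz ψ) =
      ∫ ξ, Complex.exp (-((⟪ξ, x⟫ : ℝ) : ℂ) * Complex.I) *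
        ((t * Real.sinc (t * ‖ξ‖) : ℝ) : ℂ) * ψ ξ := by
  have hpi : (2 * Real.pi) ≠ 0 := Real.two_pi_pos.ne'
  set χ : 𝓢(Space k, ℂ) := SchwartzMap.compCLMOfContinuousLinearEquiv ℂ
      (ContinuousLinearEquiv.neg ℝ (M := Space k))
      (SchwartzMap.compSubConstCLM ℂ (-x) (fourierSchwartz ψ)) with hχdef
  have hχ : ∀ z, χ z = fourierSchwartz ψ (x - z) := fun z => by
    simp [hχdef, sub_eq_add_neg, add_comm]
  rw [reflectTranslate_apply x _ _ χ hχ, waveKernel_apply]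
  set f : Space k → ℂ := fun ξ => Complex.exp (-((⟪ξ, x⟫ : ℝ) : ℂ) * Complex.I) *
        ((t * Real.sinc (t * ‖ξ‖) : ℝ) : ℂ) * ψ ξ with hf
  have e3 := Measure.integral_comp_smul (volume : Measure (Space k)) f (-(2 * Real.pi))
  have e4 : ∫ η, (𝓕⁻ χ : 𝓢(Space k, ℂ)) η * waveSymbol t η =
      ∫ η, ((2 * Real.pi) ^ k : ℝ) • f (-(2 * Real.pi) • η) := by
    refine integral_congr_ae (Eventually.of_forall fun η => ?_)
    simp only [fourierInv_fourierSchwartz_sub x ψ χ hχ, waveSymbol, hf, norm_smul, inner_smul_left,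
      smul_mul_assoc]
    congr 1
    have : ‖-(2 * Real.pi)‖ = 2 * Real.pi := by
      rw [norm_neg, Real.norm_of_nonneg (by positivity)]
    rw [this, ← mul_assoc t]
    simp only [conj_trivial, neg_mul, Complex.ofReal_neg, neg_neg, mul_comm t]
    ring
  rw [e4, integral_smul, e3, smul_smul, finrank_euclideanSpace_fin]
  have : (2 * Real.pi) ^ k * |((-(2 * Real.pi)) ^ k)⁻¹| = 1 := by
    rw [abs_inv, abs_pow, abs_neg, abs_of_pos Real.two_pi_pos]
    exact mul_inv_cancel₀ (by positivity)
  rw [this, one_smul]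

theorem waveIntegrand_fourierSchwartz {k : ℕ} (t : ℝ) (x : Space k) {r : ℝ} (hr : 0 < r)
    (ψ : 𝓢(Space k, ℂ)) :
    waveIntegrand t x r (fourierSchwartz ψ) = ∫ ξ, waveMultiplier t x r ξ * ψ ξ := by
  by_cases h : r ≤ t
  · rw [waveIntegrand, if_pos ⟨hr.le, h⟩, reflectTranslate_waveKernel_fourierSchwartz]
    simp only [waveMultiplier, max_eq_left (sub_nonneg.2 h)]
  · rw [waveIntegrand, if_neg fun h' => h h'.2]
    simp [waveMultiplier_of_le (not_le.1 h).le]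

/-- A locally integrable Fourier transform is determined almost everywhere. -/
theorem HasFourierTransform.ae_eq_waveMultiplier {k : ℕ} {t r : ℝ} {x : Space k}
    {h : Space k → ℂ} (hr : 0 < r) (hh : HasFourierTransform (waveIntegrand t x r) h) :
    h =ᵐ[volume] waveMultiplier t x r := by
  refine ae_eq_of_integral_contDiff_smul_eq hh.locallyIntegrable
    (continuous_waveMultiplier t x r).locallyIntegrable     fun g hg hgs => ?_
  have hgc : HasCompactSupport fun z => (g z : ℂ) := hgs.comp_left Complex.ofReal_zero
  have e := (hh.eq_integral (hgc.toSchwartzMap (Complex.ofRealCLM.contDiff.comp hg))).symm.trans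
    (waveIntegrand_fourierSchwartz t x hr _)
  have e' : ∫ ξ, h ξ * (g ξ : ℂ) = ∫ ξ, waveMultiplier t x r ξ * (g ξ : ℂ) := e
  simpa only [Complex.real_smul, mul_comm] using e'

/-! ### The covariance of the noise in Fourier variables -/

theorem contDiff_slice {k : ℕ} (φ : Test k) (r : ℝ) :
    ContDiff ℝ ((⊤ : ℕ∞) : WithTop ℕ∞) fun y => φ (r, y) :=
  φ.contDiff.comp (contDiff_const.prodMk contDiff_id)

theorem hasCompactSupport_slice {k : ℕ} (φ : Test k) (r : ℝ) :
    HasCompactSupport fun y => φ (r, y) :=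
  φ.hasCompactSupport.comp_isClosedEmbedding (g := Prod.mk r)
    ⟨isEmbedding_prodMkRight r, by
      have : range (Prod.mk r) = (Prod.fst ⁻¹' {r} : Set (ℝ × Space k)) := by
        ext ⟨a, b⟩
        simp [eq_comm]
      rw [this]
      exact isClosed_singleton.preimage continuous_fst⟩

theorem fourier_comp_neg {k : ℕ} (g : Space k → ℝ) (ξ : Space k) :
    fourier (fun y => (g (-y) : ℂ)) ξ = starRingEnd ℂ (fourier (fun y => (g y : ℂ)) ξ) := by
  rw [fourier, fourier, ← integral_conj, ← integral_neg_eq_self]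
  refine integral_congr_ae (Eventually.of_forall fun x => ?_)
  simp [← Complex.exp_conj]

theorem fourier_convolution {k : ℕ} {f g : Space k → ℝ} (hf : Integrable f) (hg : Integrable g)
    (ξ : Space k) :
    fourier (fun x => ((convolution f g (ContinuousLinearMap.mul ℝ ℝ) volume x : ℝ) : ℂ)) ξ =
      fourier (fun y => (f y : ℂ)) ξ * fourier (fun y => (g y : ℂ)) ξ := by
  set e : Space k → ℂ := fun x => Complex.exp (-((⟪ξ, x⟫ : ℝ) : ℂ) * Complex.I) with he
  have hec : Continuous e := by fun_prop
  have hen : ∀ x, ‖e x‖ ≤ 1 := fun x => by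
    rw [he]; simp only [← Complex.ofReal_neg, Complex.norm_exp_ofReal_mul_I, le_refl]
  have h := integral_convolution (L := ContinuousLinearMap.mul ℝ ℂ)
    (hf.ofReal.bdd_mul hec.aestronglyMeasurable (Eventually.of_forall hen))
    (hg.ofReal.bdd_mul hec.aestronglyMeasurable (Eventually.of_forall hen))
  simp only [ContinuousLinearMap.mul_apply'] at h
  rw [fourier, fourier, fourier]
  refine Eq.trans ?_ h
  refine integral_congr_ae (Eventually.of_forall fun x => ?_)
  simp only [convolution, ContinuousLinearMap.mul_apply', ← integral_complex_ofReal]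
  rw [← integral_const_mul]
  refine integral_congr_ae (Eventually.of_forall fun y => ?_)
  have : e x = e y * e (x - y) := by
    rw [he]
    simp only [← Complex.exp_add, inner_sub_right]
    congr 1
    push_cast
    ring
  change e x * ((f y * g (x - y) : ℝ) : ℂ) = e y * (f y : ℂ) * (e (x - y) * (g (x - y) : ℂ))
  rw [this, Complex.ofReal_mul]
  ring

/-- Parseval's identity for the covariance of the noise at a fixed time. -/
theorem IsSpectralMeasure.integral_convolution_slice {k : ℕ} {Γ μ : Measure (Space k)}
    (hΓ : IsSpectralMeasure Γ μ) (φ ψ : Test k) (r : ℝ) :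
    ∫ x, convolution (fun y => φ (r, y)) (fun y => ψ (r, -y))
        (ContinuousLinearMap.mul ℝ ℝ) volume x ∂Γ =
      ∫ ξ, (fourier (fun y => (φ (r, y) : ℂ)) ξ *
        starRingEnd ℂ (fourier (fun y => (ψ (r, y) : ℂ)) ξ)).re ∂μ := by
  have := hΓ.temperedSpectral
  have hf := contDiff_slice φ r
  have hfs := hasCompactSupport_slice φ r
  have hg : ContDiff ℝ ((⊤ : ℕ∞) : WithTop ℕ∞) fun y => ψ (r, -y) :=
    (contDiff_slice ψ r).comp contDiff_neg
  have hgs : HasCompactSupport fun y => ψ (r, -y) :=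
    (hasCompactSupport_slice ψ r).comp_homeomorph (Homeomorph.neg (Space k))
  set c := convolution (fun y => φ (r, y)) (fun y => ψ (r, -y))
        (ContinuousLinearMap.mul ℝ ℝ) volume with hc
  have hcd : ContDiff ℝ ((⊤ : ℕ∞) : WithTop ℕ∞) c :=
    hgs.contDiff_convolution_right _ hf.continuous.locallyIntegrable hg
  have hcs : HasCompactSupport c := hfs.convolution _ hgs
  have hcs' : HasCompactSupport fun x => (c x : ℂ) := hcs.comp_left Complex.ofReal_zero
  set χ : 𝓢(Space k, ℂ) := hcs'.toSchwartzMap (Complex.ofRealCLM.contDiff.comp hcd)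
  have hχ : ∀ ξ, fourierSchwartz χ ξ = fourier (fun y => (φ (r, y) : ℂ)) ξ *
        starRingEnd ℂ (fourier (fun y => (ψ (r, y) : ℂ)) ξ) := fun ξ => by
    rw [fourierSchwartz_apply, ← fourier_comp_neg (fun y => ψ (r, y))]
    exact fourier_convolution (hf.continuous.integrable_of_hasCompactSupport hfs)
      (hg.continuous.integrable_of_hasCompactSupport hgs) ξ
  have h := hΓ.eq_fourier χ
  simp only [← fourierSchwartz_apply] at h
  have h1 : ∫ x, χ x ∂Γ = ((∫ x, c x ∂Γ : ℝ) : ℂ) := integral_complex_ofReal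
  rw [h1] at h
  have h2 := congrArg Complex.re h
  rw [Complex.ofReal_re] at h2
  rw [h2]
  simp only [← hχ]
  exact (integral_re ((fourierSchwartz χ).integrable)).symm

theorem stronglyMeasurable_fourier_slice {k : ℕ} (φ : Test k) :
    StronglyMeasurable fun p : ℝ × Space k => fourier (fun y => (φ (p.1, y) : ℂ)) p.2 := by
  have h : Continuous fun q : (ℝ × Space k) × Space k =>
      Complex.exp (-((⟪q.1.2, q.2⟫ : ℝ) : ℂ) * Complex.I) * (φ (q.1.1, q.2) : ℂ) := by
    have := φ.continuous
    fun_prop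
  exact h.stronglyMeasurable.integral_prod_right'

/-! ### Second moments of the increments of the solution -/

section

/-- The measure `dr μ(dξ)` on `ℝ₊ × ℝ^k`. The stochastic integral is an isometry from (a subspace
of) its `L²` space. -/
noncomputable abbrev spaceTimeMeasure {k : ℕ} (μ : Measure (Space k)) : Measure (ℝ × Space k) :=
  (volume.restrict (Ioi (0 : ℝ))).prod μ

/-- The Fourier transform in space of a test function. -/
noncomputable def testSymbol {k : ℕ} (φ : Test k) (p : ℝ × Space k) : ℂ :=
  fourier (fun y => (φ (p.1, y) : ℂ)) p.2

variable {Ω : Type*} [MeasurableSpace Ω] {P : Measure Ω} {k d : ℕ} {Γ μ : Measure (Space k)}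

/-- `φ ↦ F(φ)` is isometric from the `L²` space of `dr μ(dξ)`, as a real Hilbert space. -/
theorem IsHomogeneousNoise.integral_mul_eq_inner [SFinite μ] {F : Fin d → Test k → Ω → ℝ}
    (hF : IsHomogeneousNoise P Γ F) (hΓ : IsSpectralMeasure Γ μ) (i j : Fin d) {φ ψ : Test k}
    (hφ : MemLp (testSymbol φ) 2 (spaceTimeMeasure μ))
    (hψ : MemLp (testSymbol ψ) 2 (spaceTimeMeasure μ)) :
    ∫ ω, F i φ ω * F j ψ ω ∂P = if i = j then ⟪hφ.toLp, hψ.toLp⟫ else 0 := by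
  rw [hF.covariance]
  congr 1
  have hae : (fun p => ⟪hφ.toLp (testSymbol φ) p, hψ.toLp (testSymbol ψ) p⟫) =ᵐ[spaceTimeMeasure μ]
      fun p => (testSymbol φ p * starRingEnd ℂ (testSymbol ψ p)).re := by
    filter_upwards [hφ.coeFn_toLp, hψ.coeFn_toLp] with p h1 h2
    rw [h1, h2, Complex.inner]
    simp only [Complex.mul_re, Complex.conj_re, Complex.conj_im]
    ring
  rw [L2.inner_def, integral_congr_ae hae,
    integral_prod _ ((integrable_congr hae).1 (L2.integrable_inner _ _))]
  exact integral_congr_ae (Eventually.of_forall fun r => hΓ.integral_convolution_slice φ ψ r)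

theorem IsHomogeneousNoise.memLp_two {F : Fin d → Test k → Ω → ℝ}
    (hF : IsHomogeneousNoise P Γ F) (i : Fin d) (φ : Test k) : MemLp (F i φ) 2 P :=
  (hF.gaussian.hasGaussianLaw_eval (i, φ)).memLp_two

/-- The test functions that define the stochastic integral of the wave kernel can be taken with
symbols in the `L²` space of `dr μ(dξ)`, where they converge to `waveMultiplier`. -/
theorem IsStochasticIntegral.exists_tendsto [SFinite μ] (hμ : μ ≪ volume)
    {F : Test k → Ω → ℝ} {t : ℝ} {x : Space k} {X : Ω → ℝ}
    (hX : IsStochasticIntegral P μ F (waveIntegrand t x) X)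
    (hH : MemLp (Function.uncurry (waveMultiplier t x)) 2 (spaceTimeMeasure μ)) :
    ∃ (φ : ℕ → Test k) (hφ : ∀ n, MemLp (testSymbol (φ n)) 2 (spaceTimeMeasure μ)),
      Tendsto (fun n => (hφ n).toLp) atTop (𝓝 hH.toLp) ∧
      Tendsto (fun n => eLpNorm (fun ω => F (φ n) ω - X ω) 2 P) atTop (𝓝 0) := by
  obtain ⟨-, h, φ, hh, hlim, hFlim⟩ := hX
  set H := Function.uncurry (waveMultiplier t x) with hHdef
  have hm : ∀ n, StronglyMeasurable (testSymbol (φ n) - H) := fun n =>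
    (stronglyMeasurable_fourier_slice (φ n)).sub
      (continuous_uncurry_waveMultiplier t x).stronglyMeasurable
  have e : ∀ n, ∫⁻ r in Ioi (0 : ℝ), ∫⁻ ξ,
      ‖fourier (fun y => (φ n (r, y) : ℂ)) ξ - h r ξ‖ₑ ^ 2 ∂μ =
      ∫⁻ p, ‖(testSymbol (φ n) - H) p‖ₑ ^ 2 ∂spaceTimeMeasure μ := fun n => by
    rw [lintegral_prod _ ((hm n).measurable.enorm.pow_const 2).aemeasurable]
    refine setLIntegral_congr_fun measurableSet_Ioi fun r hr => ?_
    refine lintegral_congr_ae ?_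
    filter_upwards [hμ.ae_eq ((hh r hr).ae_eq_waveMultiplier hr)] with ξ hξ
    rw [hξ]
    rfl
  have hnorm : ∀ n, eLpNorm (testSymbol (φ n) - H) 2 (spaceTimeMeasure μ) =
      (∫⁻ p, ‖(testSymbol (φ n) - H) p‖ₑ ^ 2 ∂spaceTimeMeasure μ) ^ (1 / 2 : ℝ) := fun n => by
    rw [eLpNorm_eq_lintegral_rpow_enorm_toReal two_ne_zero ENNReal.ofNat_ne_top]
    simp
  have hlim' : Tendsto (fun n => eLpNorm (testSymbol (φ n) - H) 2 (spaceTimeMeasure μ))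
      atTop (𝓝 0) := by
    have := (ENNReal.continuous_rpow_const (y := 1 / 2)).tendsto 0 |>.comp hlim
    rw [ENNReal.zero_rpow_of_pos (by norm_num)] at this
    simpa only [Function.comp_def, e, ← hnorm] using this
  -- finitely many test functions may have symbols of infinite norm; they are dropped
  obtain ⟨N, hN⟩ := eventually_atTop.1 (hlim'.eventually_lt_const ENNReal.zero_lt_top)
  have hφ : ∀ n, MemLp (testSymbol (φ (n + N))) 2 (spaceTimeMeasure μ) := fun n => by
    have h1 : MemLp (testSymbol (φ (n + N)) - H) 2 (spaceTimeMeasure μ) :=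
      ⟨(hm _).aestronglyMeasurable, hN _ (Nat.le_add_left _ _)⟩
    simpa using h1.add hH
  refine ⟨fun n => φ (n + N), hφ, ?_, hFlim.comp (tendsto_add_atTop_nat N)⟩
  rw [Lp.tendsto_Lp_iff_tendsto_eLpNorm'']
  exact hlim'.comp (tendsto_add_atTop_nat N)

/-- The isometry property of the stochastic integral of the wave kernel, in polarized form. -/
theorem IsHomogeneousNoise.inner_stochasticIntegral [SFinite μ] (hμ : μ ≪ volume)
    {F : Fin d → Test k → Ω → ℝ} (hF : IsHomogeneousNoise P Γ F) (hΓ : IsSpectralMeasure Γ μ)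
    {i j : Fin d} {t s : ℝ} {x y : Space k} {X Y : Ω → ℝ}
    (hX : IsStochasticIntegral P μ (F i) (waveIntegrand t x) X)
    (hY : IsStochasticIntegral P μ (F j) (waveIntegrand s y) Y)
    (ht : MemLp (Function.uncurry (waveMultiplier t x)) 2 (spaceTimeMeasure μ))
    (hs : MemLp (Function.uncurry (waveMultiplier s y)) 2 (spaceTimeMeasure μ)) :
    ⟪hX.1.toLp, hY.1.toLp⟫ = if i = j then ⟪ht.toLp, hs.toLp⟫ else 0 := by
  obtain ⟨φ, hφ, hφt, hφX⟩ := hX.exists_tendsto hμ ht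
  obtain ⟨ψ, hψ, hψs, hψY⟩ := hY.exists_tendsto hμ hs
  have h1 := (Lp.tendsto_Lp_iff_tendsto_eLpNorm'' (fun n => F i (φ n))
    (fun n => hF.memLp_two i (φ n)) X hX.1).2 hφX
  have h2 := (Lp.tendsto_Lp_iff_tendsto_eLpNorm'' (fun n => F j (ψ n))
    (fun n => hF.memLp_two j (ψ n)) Y hY.1).2 hψY
  have h3 := h1.inner (𝕜 := ℝ) h2
  have h4 : Tendsto (fun n => if i = j then ⟪(hφ n).toLp, (hψ n).toLp⟫ else 0) atTop
      (𝓝 (if i = j then ⟪ht.toLp, hs.toLp⟫ else 0)) := by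
    split_ifs
    · exact hφt.inner hψs
    · exact tendsto_const_nhds
  refine tendsto_nhds_unique h3 (h4.congr fun n => ?_)
  rw [← hF.integral_mul_eq_inner hΓ i j (hφ n) (hψ n), L2.inner_def]
  refine integral_congr_ae ?_
  filter_upwards [(hF.memLp_two i (φ n)).coeFn_toLp, (hF.memLp_two j (ψ n)).coeFn_toLp] with ω a b
  rw [a, b]
  simp [mul_comm]

/-- The second moment of an increment of the solution is a multiple of the squared `L²` distance of
the symbols. -/
theorem IsWaveSolution.integral_norm_sub_sq [SFinite μ] (hμ : μ ≪ volume)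
    {F : Fin d → Test k → Ω → ℝ} (hF : IsHomogeneousNoise P Γ F) (hΓ : IsSpectralMeasure Γ μ)
    {σ : Matrix (Fin d) (Fin d) ℝ} {T : ℝ} {u : ℝ → Space k → Ω → EuclideanSpace ℝ (Fin d)}
    (hu : IsWaveSolution P μ F σ T u) {t s : ℝ} (htT : t ∈ Icc 0 T) (hsT : s ∈ Icc 0 T)
    (x y : Space k)
    (ht : MemLp (Function.uncurry (waveMultiplier t x)) 2 (spaceTimeMeasure μ))
    (hs : MemLp (Function.uncurry (waveMultiplier s y)) 2 (spaceTimeMeasure μ)) :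
    Integrable (fun ω => ‖u t x ω - u s y ω‖ ^ 2) P ∧
    ∫ ω, ‖u t x ω - u s y ω‖ ^ 2 ∂P = (∑ i, ∑ j, σ i j ^ 2) *
      (∫⁻ p, ‖waveMultiplier t x p.1 p.2 - waveMultiplier s y p.1 p.2‖ₑ ^ 2
        ∂spaceTimeMeasure μ).toReal := by
  obtain ⟨v, hv, hvu⟩ := hu t htT x
  obtain ⟨w, hw, hwu⟩ := hu s hsT y
  set N := (∫⁻ p, ‖waveMultiplier t x p.1 p.2 - waveMultiplier s y p.1 p.2‖ₑ ^ 2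
        ∂spaceTimeMeasure μ).toReal with hN
  have hZ : ∀ j, MemLp (v j - w j) 2 P := fun j => (hv j).1.sub (hw j).1
  have hint : ∀ j l, Integrable (fun ω => (v j ω - w j ω) * (v l ω - w l ω)) P := fun j l =>
    (hZ j).integrable_mul (hZ l)
  have hnorm : ⟪ht.toLp - hs.toLp, ht.toLp - hs.toLp⟫ = N := by
    rw [real_inner_self_eq_norm_sq, ← MemLp.toLp_sub, Lp.norm_toLp,
      eLpNorm_eq_lintegral_rpow_enorm_toReal two_ne_zero ENNReal.ofNat_ne_top, hN,
      ← ENNReal.toReal_pow, ← ENNReal.rpow_natCast, ← ENNReal.rpow_mul]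
    simp [Function.uncurry_def]
  have hcov : ∀ j l, ∫ ω, (v j ω - w j ω) * (v l ω - w l ω) ∂P = if j = l then N else 0 := by
    intro j l
    have e : ∫ ω, (v j ω - w j ω) * (v l ω - w l ω) ∂P = ⟪(hZ j).toLp, (hZ l).toLp⟫ := by
      rw [L2.inner_def]
      refine integral_congr_ae ?_
      filter_upwards [(hZ j).coeFn_toLp, (hZ l).coeFn_toLp] with ω a b
      rw [a, b]
      simp [mul_comm]
    rw [e, MemLp.toLp_sub (hv j).1 (hw j).1, MemLp.toLp_sub (hv l).1 (hw l).1]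
    simp only [inner_sub_left, inner_sub_right,
      hF.inner_stochasticIntegral hμ hΓ (hv j) (hv l) ht ht,
      hF.inner_stochasticIntegral hμ hΓ (hv j) (hw l) ht hs,
      hF.inner_stochasticIntegral hμ hΓ (hw j) (hv l) hs ht,
      hF.inner_stochasticIntegral hμ hΓ (hw j) (hw l) hs hs]
    rw [← hnorm]
    simp only [inner_sub_left, inner_sub_right]
    split_ifs <;> ring
  have hae : (fun ω => ‖u t x ω - u s y ω‖ ^ 2) =ᵐ[P] fun ω =>
      ∑ i, ∑ j, ∑ l, σ i j * σ i l * ((v j ω - w j ω) * (v l ω - w l ω)) := by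
    filter_upwards [hvu, hwu] with ω a b
    rw [EuclideanSpace.norm_sq_eq]
    refine Finset.sum_congr rfl fun i _ => ?_
    rw [PiLp.sub_apply, a, b, ← Finset.sum_sub_distrib, Real.norm_eq_abs, sq_abs, sq,
      Finset.sum_mul_sum]
    refine Finset.sum_congr rfl fun j _ => Finset.sum_congr rfl fun l _ => ?_
    ring
  have hint' : ∀ i j l, Integrable
      (fun ω => σ i j * σ i l * ((v j ω - w j ω) * (v l ω - w l ω))) P :=
    fun i j l => (hint j l).const_mul _
  constructor
  · refine (integrable_congr hae).2 ?_
    exact integrable_finsetSum _ fun i _ => integrable_finsetSum _ fun j _ =>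
      integrable_finsetSum _ fun l _ => hint' i j l
  · rw [integral_congr_ae hae, integral_finsetSum _ fun i _ => integrable_finsetSum _ fun j _ =>
      integrable_finsetSum _ fun l _ => hint' i j l, Finset.sum_mul]
    refine Finset.sum_congr rfl fun i _ => ?_
    rw [integral_finsetSum _ fun j _ => integrable_finsetSum _ fun l _ => hint' i j l,
      Finset.sum_mul]
    refine Finset.sum_congr rfl fun j _ => ?_
    rw [integral_finsetSum _ fun l _ => hint' i j l]
    simp only [integral_const_mul, hcov]
    simp [sq]

end

/-! ### Upper bound for the increments -/

theorem mul_sinc_mul (τ n : ℝ) : τ * Real.sinc (τ * n) * n = Real.sin (τ * n) := by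
  by_cases h : τ * n = 0
  · rw [h, Real.sin_zero, Real.sinc_zero, mul_one, h]
  · rw [Real.sinc_of_ne_zero h]
    have := left_ne_zero_of_mul h
    have := right_ne_zero_of_mul h
    field_simp

theorem waveMultiplier_mul_norm {k : ℕ} (t : ℝ) (x : Space k) (r : ℝ) (ξ : Space k) :
    waveMultiplier t x r ξ * (‖ξ‖ : ℂ) =
      Complex.exp (-((⟪ξ, x⟫ : ℝ) : ℂ) * Complex.I) * (Real.sin (max (t - r) 0 * ‖ξ‖) : ℂ) := by
  rw [waveMultiplier, mul_assoc, ← Complex.ofReal_mul, mul_sinc_mul]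

theorem norm_exp_neg_inner {k : ℕ} (x ξ : Space k) :
    ‖Complex.exp (-((⟪ξ, x⟫ : ℝ) : ℂ) * Complex.I)‖ = 1 := by
  rw [← Complex.ofReal_neg, Complex.norm_exp_ofReal_mul_I]

theorem norm_exp_neg_inner_sub_le {k : ℕ} (x y ξ : Space k) :
    ‖Complex.exp (-((⟪ξ, x⟫ : ℝ) : ℂ) * Complex.I) -
      Complex.exp (-((⟪ξ, y⟫ : ℝ) : ℂ) * Complex.I)‖ ≤ ‖x - y‖ * ‖ξ‖ := by
  have h : Complex.exp (-((⟪ξ, x⟫ : ℝ) : ℂ) * Complex.I) =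
      Complex.exp (-((⟪ξ, y⟫ : ℝ) : ℂ) * Complex.I) *
        Complex.exp (Complex.I * ((-⟪ξ, x - y⟫ : ℝ) : ℂ)) := by
    rw [← Complex.exp_add, inner_sub_right]
    congr 1
    push_cast
    ring
  rw [h, ← mul_sub_one, norm_mul, norm_exp_neg_inner, one_mul]
  refine Real.norm_exp_I_mul_ofReal_sub_one_le.trans ?_
  rw [norm_neg, mul_comm]
  exact norm_inner_le_norm _ _

theorem norm_waveMultiplier_sub_mul_le {k : ℕ} (t s : ℝ) (x y : Space k) (r : ℝ) (ξ : Space k) :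
    ‖waveMultiplier t x r ξ - waveMultiplier s y r ξ‖ * ‖ξ‖ ≤
      min 2 ((|t - s| + ‖x - y‖) * ‖ξ‖) := by
  have hn : ‖waveMultiplier t x r ξ - waveMultiplier s y r ξ‖ * ‖ξ‖ =
      ‖waveMultiplier t x r ξ * (‖ξ‖ : ℂ) - waveMultiplier s y r ξ * (‖ξ‖ : ℂ)‖ := by
    rw [← sub_mul, norm_mul, Complex.norm_real, norm_norm]
  rw [hn, waveMultiplier_mul_norm, waveMultiplier_mul_norm]
  set a := Real.sin (max (t - r) 0 * ‖ξ‖) with ha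
  set b := Real.sin (max (s - r) 0 * ‖ξ‖) with hb
  have ha1 : |a| ≤ 1 := Real.abs_sin_le_one _
  have hb1 : |b| ≤ 1 := Real.abs_sin_le_one _
  refine le_min ?_ ?_
  · refine (norm_sub_le _ _).trans ?_
    rw [norm_mul, norm_mul, norm_exp_neg_inner, norm_exp_neg_inner, Complex.norm_real,
      Complex.norm_real, Real.norm_eq_abs, Real.norm_eq_abs]
    linarith
  · have hab : |a - b| ≤ |t - s| * ‖ξ‖ := by
      refine (Real.abs_sin_sub_sin_le _ _).trans ?_
      rw [← sub_mul, abs_mul, abs_norm]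
      refine mul_le_mul_of_nonneg_right ?_ (norm_nonneg _)
      refine (abs_max_sub_max_le_abs (t - r) (s - r) 0).trans_eq ?_
      congr 1
      ring
    have e : ∀ p q : ℂ, p * (a : ℂ) - q * (b : ℂ) = (p - q) * (a : ℂ) + q * ((a - b : ℝ) : ℂ) :=
      fun p q => by push_cast; ring
    rw [e]
    refine (norm_add_le _ _).trans ?_
    rw [norm_mul, norm_mul, norm_exp_neg_inner, Complex.norm_real, Complex.norm_real,
      Real.norm_eq_abs, Real.norm_eq_abs, one_mul]
    have h1 := mul_le_mul (norm_exp_neg_inner_sub_le x y ξ) ha1 (abs_nonneg _) (by positivity)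
    nlinarith

/-- `min(2, ‖η‖)² / ‖η‖²` times the spectral density `‖η‖^(-k+β)`. -/
noncomputable def radialBound (k : ℕ) (β n : ℝ) : ℝ := min 2 n ^ 2 * n ^ (β - k - 2)

theorem radialBound_nonneg (k : ℕ) (β : ℝ) {n : ℝ} (hn : 0 ≤ n) : 0 ≤ radialBound k β n := by
  unfold radialBound
  positivity

/-- The condition `0 < β` gives integrability near the origin, `β < 2` at infinity. -/
theorem integrable_radialBound {k : ℕ} {β : ℝ} (hk : 0 < k) (h0 : 0 < β) (h2 : β < 2) :
    Integrable fun η : Space k => radialBound k β ‖η‖ := by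
  have : Nonempty (Fin k) := ⟨⟨0, hk⟩⟩
  refine (integrable_fun_norm_addHaar (volume : Measure (Space k))
    (f := fun n => radialBound k β n)).2 ?_
  rw [finrank_euclideanSpace_fin, ← Ioc_union_Ioi_eq_Ioi (zero_le_one' ℝ)]
  have hm : Measurable fun n : ℝ => n ^ (k - 1) • radialBound k β n := by
    unfold radialBound
    fun_prop
  have e : ∀ n : ℝ, 0 < n → n ^ (k - 1) • radialBound k β n = min 2 n ^ 2 * n ^ (β - 3) := by
    intro n hn
    rw [radialBound, smul_eq_mul, mul_left_comm, ← Real.rpow_natCast n (k - 1), ← Real.rpow_add hn,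
      Nat.cast_sub (show 1 ≤ k from hk)]
    congr 2
    push_cast
    ring
  refine IntegrableOn.union ?_ ?_
  · have h := (intervalIntegral.intervalIntegrable_rpow' (a := 0) (b := 1)
      (r := β - 1) (by linarith)).1
    refine h.mono' hm.aestronglyMeasurable ?_
    filter_upwards [ae_restrict_mem measurableSet_Ioc] with n hn
    have hn0 : 0 ≤ n := hn.1.le
    rw [e n hn.1, Real.norm_of_nonneg (by positivity), min_eq_right (by linarith [hn.2]),
      ← Real.rpow_natCast, ← Real.rpow_add hn.1]
    refine le_of_eq ?_
    congr 1
    push_cast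
    ring
  · have h := (integrableOn_Ioi_rpow_of_lt (a := β - 3) (c := 1) (by linarith) one_pos).const_mul 4
    refine h.mono' hm.aestronglyMeasurable ?_
    filter_upwards [ae_restrict_mem measurableSet_Ioi] with n hn
    have hn0 : 0 < n := one_pos.trans hn
    rw [e n hn0, Real.norm_of_nonneg (by positivity)]
    gcongr
    have h1 : min 2 n ≤ 2 := min_le_left _ _
    have h3 : 0 ≤ min 2 n := by positivity
    nlinarith

theorem HypBeta.pos_dim {k : ℕ} {μ : Measure (Space k)} {β : ℝ} (h : HypBeta μ β) : 0 < k := by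
  have := h.pos.trans h.lt_dim
  exact_mod_cast this

theorem HypBeta.lintegral_eq {k : ℕ} {μ : Measure (Space k)} {β : ℝ} (h : HypBeta μ β)
    {g : Space k → ℝ≥0∞} (hg : Measurable g) :
    ∫⁻ ξ, g ξ ∂μ = ∫⁻ ξ, ENNReal.ofReal (‖ξ‖ ^ (-(k : ℝ) + β)) * g ξ := by
  rw [h.eq_withDensity, lintegral_withDensity_eq_lintegral_mul _ (by fun_prop) hg]
  rfl

theorem HypBeta.absolutelyContinuous {k : ℕ} {μ : Measure (Space k)} {β : ℝ} (h : HypBeta μ β) :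
    μ ≪ volume := by
  rw [h.eq_withDensity]
  exact withDensity_absolutelyContinuous _ _

theorem HypBeta.sFinite {k : ℕ} {μ : Measure (Space k)} {β : ℝ} (h : HypBeta μ β) :
    SFinite μ := by
  rw [h.eq_withDensity]
  infer_instance

theorem measurable_enorm_waveMultiplier_sub {k : ℕ} (t s : ℝ) (x y : Space k) :
    Measurable fun p : ℝ × Space k =>
      ‖waveMultiplier t x p.1 p.2 - waveMultiplier s y p.1 p.2‖ₑ ^ 2 :=
  (((continuous_uncurry_waveMultiplier t x).sub
    (continuous_uncurry_waveMultiplier s y)).measurable.enorm).pow_const 2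

/-- The bound `min(2, ρ ‖ξ‖) / ‖ξ‖` for the difference of the symbols, squared and weighted with the
spectral density. At `ξ = 0` it holds because the power of `0` on the left is `0`. -/
theorem rpow_mul_norm_sq_waveMultiplier_sub_le {k : ℕ} {β : ℝ} (hβ : β < k) {t s : ℝ}
    {x y : Space k} (hρ : 0 < |t - s| + ‖x - y‖) (r : ℝ) (ξ : Space k) :
    ‖ξ‖ ^ (-(k : ℝ) + β) * ‖waveMultiplier t x r ξ - waveMultiplier s y r ξ‖ ^ 2 ≤
      (|t - s| + ‖x - y‖) ^ (k + 2 - β) * radialBound k β ‖(|t - s| + ‖x - y‖) • ξ‖ := by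
  have h1 := norm_waveMultiplier_sub_mul_le t s x y r ξ
  generalize |t - s| + ‖x - y‖ = ρ at hρ h1 ⊢
  have hD := norm_nonneg (waveMultiplier t x r ξ - waveMultiplier s y r ξ)
  generalize ‖waveMultiplier t x r ξ - waveMultiplier s y r ξ‖ = D at h1 hD ⊢
  rcases (norm_nonneg ξ).eq_or_lt with h0 | h0
  · rw [← h0, Real.zero_rpow (by linarith), zero_mul]
    exact mul_nonneg (by positivity) (radialBound_nonneg k β (norm_nonneg _))
  · rw [radialBound, norm_smul, Real.norm_of_nonneg hρ.le]
    have h2 : (D * ‖ξ‖) ^ 2 ≤ min 2 (ρ * ‖ξ‖) ^ 2 := by gcongr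
    have e1 : ‖ξ‖ ^ (-(k : ℝ) + β) = ‖ξ‖ ^ (β - k - 2) * ‖ξ‖ ^ 2 := by
      rw [← Real.rpow_natCast, ← Real.rpow_add h0]
      congr 1
      push_cast
      ring
    have e2 : ρ ^ (k + 2 - β) * ρ ^ (β - k - 2) = 1 := by
      rw [← Real.rpow_add hρ]
      convert Real.rpow_zero ρ using 2
      ring
    rw [Real.mul_rpow hρ.le h0.le, e1]
    calc ‖ξ‖ ^ (β - k - 2) * ‖ξ‖ ^ 2 * D ^ 2 = ‖ξ‖ ^ (β - k - 2) * (D * ‖ξ‖) ^ 2 := by ring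
      _ ≤ ‖ξ‖ ^ (β - k - 2) * min 2 (ρ * ‖ξ‖) ^ 2 := by gcongr
      _ = (ρ ^ (k + 2 - β) * ρ ^ (β - k - 2)) *
          (‖ξ‖ ^ (β - k - 2) * min 2 (ρ * ‖ξ‖) ^ 2) := by rw [e2, one_mul]
      _ = _ := by ring

theorem integral_rpow_mul_radialBound_smul {k : ℕ} (β : ℝ) {ρ : ℝ} (hρ : 0 < ρ) :
    ∫ ξ : Space k, ρ ^ (k + 2 - β) * radialBound k β ‖ρ • ξ‖ =
      (∫ η : Space k, radialBound k β ‖η‖) * ρ ^ (2 - β) := by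
  rw [integral_const_mul, Measure.integral_comp_smul volume
    (fun η : Space k => radialBound k β ‖η‖) ρ, finrank_euclideanSpace_fin,
    abs_of_nonneg (by positivity), smul_eq_mul, ← mul_assoc, mul_comm]
  congr 1
  rw [← Real.rpow_natCast, ← Real.rpow_neg hρ.le, ← Real.rpow_add hρ]
  congr 1
  ring

theorem HypBeta.lintegral_enorm_waveMultiplier_sub_le {k : ℕ} {μ : Measure (Space k)} {β : ℝ}
    (h : HypBeta μ β) {t s : ℝ} {x y : Space k} (hρ : 0 < |t - s| + ‖x - y‖) (r : ℝ) :
    ∫⁻ ξ, ‖waveMultiplier t x r ξ - waveMultiplier s y r ξ‖ₑ ^ 2 ∂μ ≤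
      ENNReal.ofReal ((∫ η : Space k, radialBound k β ‖η‖) * (|t - s| + ‖x - y‖) ^ (2 - β)) := by
  have hint := integrable_radialBound h.pos_dim h.pos h.lt_two
  have hm : Measurable fun ξ => ‖waveMultiplier t x r ξ - waveMultiplier s y r ξ‖ₑ ^ 2 :=
    (((continuous_waveMultiplier t x r).sub
      (continuous_waveMultiplier s y r)).measurable.enorm).pow_const 2
  rw [h.lintegral_eq hm, ← integral_rpow_mul_radialBound_smul β hρ,
    ofReal_integral_eq_lintegral_ofReal ((hint.comp_smul hρ.ne').const_mul _)
      (Eventually.of_forall fun ξ =>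
        mul_nonneg (by positivity) (radialBound_nonneg k β (norm_nonneg _)))]
  refine lintegral_mono fun ξ => ?_
  rw [← ofReal_norm, ← ENNReal.ofReal_pow (norm_nonneg _),
    ← ENNReal.ofReal_mul (by positivity)]
  exact ENNReal.ofReal_le_ofReal (rpow_mul_norm_sq_waveMultiplier_sub_le h.lt_dim hρ r ξ)

/-- Upper bound for the squared `L²` distance of the symbols, which vanish after time `T`. -/
theorem HypBeta.lintegral_increment_le {k : ℕ} {μ : Measure (Space k)} {β : ℝ}
    (h : HypBeta μ β) {T t s : ℝ} (hT : 0 ≤ T) (ht : t ≤ T) (hs : s ≤ T) (x y : Space k) :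
    ∫⁻ p, ‖waveMultiplier t x p.1 p.2 - waveMultiplier s y p.1 p.2‖ₑ ^ 2 ∂spaceTimeMeasure μ ≤
      ENNReal.ofReal (T * (∫ η : Space k, radialBound k β ‖η‖) *
        (|t - s| + ‖x - y‖) ^ (2 - β)) := by
  have := h.sFinite
  rcases (show 0 ≤ |t - s| + ‖x - y‖ by positivity).eq_or_lt with h0 | hρ
  · have h1 : t = s := by
      have : |t - s| = 0 := by linarith [abs_nonneg (t - s), norm_nonneg (x - y)]
      linarith [abs_eq_zero.1 this]
    have h2 : x = y := by
      have : ‖x - y‖ = 0 := by linarith [abs_nonneg (t - s), norm_nonneg (x - y)]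
      exact sub_eq_zero.1 (norm_eq_zero.1 this)
    simp [h1, h2]
  rw [lintegral_prod _ (measurable_enorm_waveMultiplier_sub t s x y).aemeasurable]
  set B := (∫ η : Space k, radialBound k β ‖η‖) * (|t - s| + ‖x - y‖) ^ (2 - β)
  calc _ ≤ ∫⁻ r in Ioi (0 : ℝ), (Iio T).indicator (fun _ => ENNReal.ofReal B) r := by
        refine lintegral_mono fun r => ?_
        by_cases hr : r < T
        · rw [indicator_of_mem (mem_Iio.2 hr)]
          exact h.lintegral_enorm_waveMultiplier_sub_le hρ r
        · have hr' := not_lt.1 hr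
          simp [waveMultiplier_of_le (ht.trans hr'), waveMultiplier_of_le (hs.trans hr')]
    _ = ENNReal.ofReal B * ENNReal.ofReal T := by
        rw [lintegral_indicator_const measurableSet_Iio, Measure.restrict_apply measurableSet_Iio,
          Iio_inter_Ioi, Real.volume_Ioo, sub_zero]
    _ = _ := by
        rw [← ENNReal.ofReal_mul' hT, mul_assoc T, mul_comm T]

theorem HypBeta.memLp_waveMultiplier {k : ℕ} {μ : Measure (Space k)} {β : ℝ}
    (h : HypBeta μ β) {t : ℝ} (ht : 0 ≤ t) (x : Space k) :
    MemLp (Function.uncurry (waveMultiplier t x)) 2 (spaceTimeMeasure μ) := by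
  have := h.sFinite
  refine ⟨(continuous_uncurry_waveMultiplier t x).aestronglyMeasurable, ?_⟩
  refine (eLpNorm_lt_top_iff_lintegral_rpow_enorm_lt_top two_ne_zero ENNReal.ofNat_ne_top).2 ?_
  -- the symbol at time `0` vanishes on `ℝ₊`
  have hle := h.lintegral_increment_le ht le_rfl ht x x (s := 0)
  refine lt_of_le_of_lt ?_ (hle.trans_lt ENNReal.ofReal_lt_top)
  refine lintegral_mono_ae ?_
  have hpos : ∀ᵐ p ∂spaceTimeMeasure μ, (0 : ℝ) < p.1 :=
    Measure.quasiMeasurePreserving_fst.ae (ae_restrict_mem measurableSet_Ioi)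
  filter_upwards [hpos] with p hp
  rw [waveMultiplier_of_le hp.le, sub_zero]
  simp [Function.uncurry_def]

/-! ### Lower bound for the increments -/

/-- The identity `|e^{ip} a - e^{iq} b|² = a² + b² - 2 a b cos (p - q)` for the symbols. -/
theorem norm_sq_waveMultiplier_sub {k : ℕ} (t s : ℝ) (x y : Space k) (r : ℝ) (ξ : Space k)
    (ht : r ≤ t) (hs : r ≤ s) :
    ‖waveMultiplier t x r ξ - waveMultiplier s y r ξ‖ ^ 2 * ‖ξ‖ ^ 2 =
      Real.sin ((t - r) * ‖ξ‖) ^ 2 + Real.sin ((s - r) * ‖ξ‖) ^ 2 -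
        2 * Real.cos ⟪ξ, x - y⟫ * (Real.sin ((t - r) * ‖ξ‖) * Real.sin ((s - r) * ‖ξ‖)) := by
  have hn : ‖waveMultiplier t x r ξ - waveMultiplier s y r ξ‖ * ‖ξ‖ =
      ‖waveMultiplier t x r ξ * (‖ξ‖ : ℂ) - waveMultiplier s y r ξ * (‖ξ‖ : ℂ)‖ := by
    rw [← sub_mul, norm_mul, Complex.norm_real, norm_norm]
  rw [← mul_pow, hn, waveMultiplier_mul_norm, waveMultiplier_mul_norm,
    max_eq_left (sub_nonneg.2 ht), max_eq_left (sub_nonneg.2 hs), ← Complex.ofReal_neg,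
    ← Complex.ofReal_neg, ← Complex.normSq_eq_norm_sq, Complex.normSq_apply, inner_sub_right,
    Real.cos_sub]
  simp only [Complex.sub_re, Complex.sub_im, Complex.re_mul_ofReal, Complex.im_mul_ofReal,
    Complex.exp_ofReal_mul_I_re, Complex.exp_ofReal_mul_I_im, Real.cos_neg, Real.sin_neg]
  linear_combination Real.sin ((t - r) * ‖ξ‖) ^ 2 * Real.sin_sq_add_cos_sq ⟪ξ, x⟫ +
    Real.sin ((s - r) * ‖ξ‖) ^ 2 * Real.sin_sq_add_cos_sq ⟪ξ, y⟫

/-- Over `m` half periods of `r ↦ sin (n r)` each squared sine averages exactly to `1 / 2` and the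
product of the two sines to `cos (n (t - s)) / 2`, so that no error term is left. -/
theorem integral_sin_sq_half_periods (t s c : ℝ) {n : ℝ} (hn : 0 < n) (m : ℕ) :
    ∫ r in (0 : ℝ)..m * Real.pi / n,
      (Real.sin ((t - r) * n) ^ 2 + Real.sin ((s - r) * n) ^ 2 -
        2 * c * (Real.sin ((t - r) * n) * Real.sin ((s - r) * n))) =
      m * Real.pi / n * (1 - c * Real.cos (n * (t - s))) := by
  have hlin : ∀ a r : ℝ, HasDerivAt (fun r => a - 2 * r * n) (-(2 * n)) r := fun a r => by
    have := (((hasDerivAt_id r).const_mul 2).mul_const n).const_sub a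
    simpa using this
  have hsin : ∀ a r : ℝ, HasDerivAt (fun r => Real.sin (a - 2 * r * n))
      (Real.cos (a - 2 * r * n) * -(2 * n)) r := fun a r => (hlin a r).sin
  have hder : ∀ r : ℝ, HasDerivAt
      (fun r => r * (1 - c * Real.cos (n * (t - s))) +
        (4 * n)⁻¹ * (Real.sin (2 * t * n - 2 * r * n) + Real.sin (2 * s * n - 2 * r * n)) -
        c * (2 * n)⁻¹ * Real.sin ((t + s) * n - 2 * r * n))
      (Real.sin ((t - r) * n) ^ 2 + Real.sin ((s - r) * n) ^ 2 -
        2 * c * (Real.sin ((t - r) * n) * Real.sin ((s - r) * n))) r := fun r => by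
    have h := (((hasDerivAt_id r).mul_const (1 - c * Real.cos (n * (t - s)))).add
      (((hsin (2 * t * n) r).add (hsin (2 * s * n) r)).const_mul (4 * n)⁻¹)).sub
      ((hsin ((t + s) * n) r).const_mul (c * (2 * n)⁻¹))
    refine h.congr_deriv ?_
    have e1 : 2 * t * n - 2 * r * n = 2 * ((t - r) * n) := by ring
    have e2 : 2 * s * n - 2 * r * n = 2 * ((s - r) * n) := by ring
    have e3 : (t + s) * n - 2 * r * n = (t - r) * n + (s - r) * n := by ring
    have e4 : n * (t - s) = (t - r) * n - (s - r) * n := by ring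
    rw [e1, e2, e3, e4, Real.cos_two_mul, Real.cos_two_mul, Real.cos_add, Real.cos_sub]
    have hA := Real.sin_sq_add_cos_sq ((t - r) * n)
    have hB := Real.sin_sq_add_cos_sq ((s - r) * n)
    generalize (t - r) * n = A at hA ⊢
    generalize (s - r) * n = B at hB ⊢
    field_simp
    linear_combination (-4 : ℝ) * hA + (-4 : ℝ) * hB
  rw [intervalIntegral.integral_eq_sub_of_hasDerivAt (fun r _ => hder r)
    (Continuous.intervalIntegrable (by fun_prop) _ _)]
  have hper : ∀ a : ℝ, Real.sin (a - 2 * (m * Real.pi / n) * n) = Real.sin a := fun a => by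
    rw [show a - 2 * (m * Real.pi / n) * n = a - m * (2 * Real.pi) by field_simp,
      Real.sin_sub_nat_mul_two_pi]
  simp only [hper, mul_zero, zero_mul, sub_zero]
  ring

theorem one_sub_cos_mul_cos_nonneg (a b : ℝ) : 0 ≤ 1 - Real.cos a * Real.cos b := by
  have h := mul_le_one₀ (Real.abs_cos_le_one a) (abs_nonneg _) (Real.abs_cos_le_one b)
  rw [← abs_mul] at h
  linarith [le_abs_self (Real.cos a * Real.cos b)]

/-- The increment at a fixed frequency, integrated over time, when `[0, t₀]` contains at least one
half period. -/
theorem lintegral_time_ge {k : ℕ} {t₀ t s : ℝ} (ht₀ : 0 < t₀) (ht : t₀ ≤ t) (hs : t₀ ≤ s)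
    (x y : Space k) {ξ : Space k} (hξ : Real.pi ≤ t₀ * ‖ξ‖) :
    ENNReal.ofReal (t₀ / 2 * (1 - Real.cos ⟪ξ, x - y⟫ * Real.cos (‖ξ‖ * (t - s))) / ‖ξ‖ ^ 2) ≤
      ∫⁻ r in Ioi (0 : ℝ), ‖waveMultiplier t x r ξ - waveMultiplier s y r ξ‖ₑ ^ 2 := by
  have hn : 0 < ‖ξ‖ := by
    by_contra h
    have := mul_nonpos_of_nonneg_of_nonpos ht₀.le (not_lt.1 h)
    linarith [Real.pi_pos]
  -- `[0, a]` consists of as many half periods as fit into `[0, t₀]`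
  set m := ⌊t₀ * ‖ξ‖ / Real.pi⌋₊ with hm
  set a := m * Real.pi / ‖ξ‖ with ha
  have hm1 : 1 ≤ m := by
    rw [hm, Nat.one_le_floor_iff, le_div_iff₀ Real.pi_pos, one_mul]
    exact hξ
  have hm1' : (1 : ℝ) ≤ m := by exact_mod_cast hm1
  have hm2 : (m : ℝ) ≤ t₀ * ‖ξ‖ / Real.pi := Nat.floor_le (by positivity)
  have hm3 : t₀ * ‖ξ‖ / Real.pi < m + 1 := Nat.lt_floor_add_one _
  have ha0 : 0 ≤ a := by positivity
  have ha1 : a ≤ t₀ := by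
    rw [ha, div_le_iff₀ hn]
    rwa [le_div_iff₀ Real.pi_pos] at hm2
  have ha2 : t₀ / 2 ≤ a := by
    rw [ha, le_div_iff₀ hn]
    rw [div_lt_iff₀ Real.pi_pos] at hm3
    nlinarith [Real.pi_pos]
  set D : ℝ → ℝ := fun r => ‖waveMultiplier t x r ξ - waveMultiplier s y r ξ‖ ^ 2 with hD
  have hDc : Continuous D :=
    ((continuous_waveMultiplier_time t x ξ).sub
      (continuous_waveMultiplier_time s y ξ)).norm.pow 2
  have hint : ∫ r in Ioc 0 a, D r =
      a * (1 - Real.cos ⟪ξ, x - y⟫ * Real.cos (‖ξ‖ * (t - s))) / ‖ξ‖ ^ 2 := by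
    rw [eq_div_iff (by positivity), ← integral_mul_const, ha,
      ← integral_sin_sq_half_periods t s (Real.cos ⟪ξ, x - y⟫) hn m, ← ha,
      intervalIntegral.integral_of_le ha0]
    refine setIntegral_congr_fun measurableSet_Ioc fun r hr => ?_
    exact norm_sq_waveMultiplier_sub t s x y r ξ (hr.2.trans (ha1.trans ht))
      (hr.2.trans (ha1.trans hs))
  calc _ ≤ ENNReal.ofReal (∫ r in Ioc 0 a, D r) := by
        rw [hint]
        refine ENNReal.ofReal_le_ofReal ?_
        have := one_sub_cos_mul_cos_nonneg ⟪ξ, x - y⟫ (‖ξ‖ * (t - s))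
        gcongr
    _ = ∫⁻ r in Ioc 0 a, ENNReal.ofReal (D r) :=
        ofReal_integral_eq_lintegral_ofReal (hDc.integrableOn_Ioc)
          (Eventually.of_forall fun r => sq_nonneg _)
    _ ≤ ∫⁻ r in Ioi 0, ENNReal.ofReal (D r) := lintegral_mono_set Ioc_subset_Ioi_self
    _ = _ := by
        refine lintegral_congr fun r => ?_
        rw [hD, ENNReal.ofReal_pow (norm_nonneg _), ofReal_norm]

/-- The closed annulus `Q ≤ ‖η‖ ≤ 2 Q`. -/
def annulus (k : ℕ) (Q : ℝ) : Set (Space k) := {η | ‖η‖ ∈ Icc Q (2 * Q)}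

theorem isCompact_annulus (k : ℕ) (Q : ℝ) : IsCompact (annulus k Q) := by
  refine (isCompact_closedBall (0 : Space k) (2 * Q)).of_isClosed_subset
    (isClosed_Icc.preimage continuous_norm) fun η hη => ?_
  rw [mem_closedBall_zero_iff]
  exact hη.2

/-- The contribution of the frequencies in the annulus of inner radius `Q` to the variogram of the
increment by `p = (h, z)` in time and space: the integral of `1 - cos ⟪η, z⟫ cos (‖η‖ h)` against
the spectral density divided by `‖η‖²`. -/
noncomputable def bandVariogram (k : ℕ) (β Q : ℝ) (p : ℝ × Space k) : ℝ :=
  ∫ η in annulus k Q, (1 - Real.cos ⟪η, p.2⟫ * Real.cos (‖η‖ * p.1)) * ‖η‖ ^ (β - k - 2)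

theorem integrableOn_norm_rpow_annulus (k : ℕ) (c : ℝ) {Q : ℝ} (hQ : 0 < Q) :
    IntegrableOn (fun η : Space k => ‖η‖ ^ c) (annulus k Q) := by
  refine ContinuousOn.integrableOn_compact (isCompact_annulus k Q) ?_
  exact continuous_norm.continuousOn.rpow_const fun η hη => Or.inl (hQ.trans_le hη.1).ne'

theorem integrableOn_bandVariogram (k : ℕ) (β : ℝ) {Q : ℝ} (hQ : 0 < Q) (p : ℝ × Space k) :
    IntegrableOn (fun η => (1 - Real.cos ⟪η, p.2⟫ * Real.cos (‖η‖ * p.1)) * ‖η‖ ^ (β - k - 2))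
      (annulus k Q) :=
  (integrableOn_norm_rpow_annulus k _ hQ).continuousOn_mul (by fun_prop) (isCompact_annulus k Q)

theorem continuous_bandVariogram (k : ℕ) (β : ℝ) {Q : ℝ} (hQ : 0 < Q) :
    Continuous (bandVariogram k β Q) := by
  refine continuous_of_dominated (bound := fun η => 2 * ‖η‖ ^ (β - k - 2))
    (fun p => (integrableOn_bandVariogram k β hQ p).aestronglyMeasurable) (fun p => ?_)
    ((integrableOn_norm_rpow_annulus k _ hQ).const_mul 2) ?_
  · refine Eventually.of_forall fun η => ?_
    rw [Real.norm_of_nonneg (mul_nonneg (one_sub_cos_mul_cos_nonneg _ _) (by positivity))]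
    gcongr
    have h := mul_le_one₀ (Real.abs_cos_le_one ⟪η, p.2⟫) (abs_nonneg _)
      (Real.abs_cos_le_one (‖η‖ * p.1))
    rw [← abs_mul] at h
    linarith [neg_abs_le (Real.cos ⟪η, p.2⟫ * Real.cos (‖η‖ * p.1))]
  · exact Eventually.of_forall fun η => by fun_prop

theorem eq_zero_of_sin_mul_eq_zero {a p q : ℝ} (hpq : p < q)
    (h : ∀ l ∈ Ioo p q, Real.sin (l * a) = 0) : a = 0 := by
  obtain ⟨l, hl⟩ := nonempty_Ioo.2 hpq
  have hd : HasDerivAt (fun l => Real.sin (l * a)) (Real.cos (l * a) * a) l := by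
    simpa using ((hasDerivAt_id l).mul_const a).sin
  have h0 : HasDerivAt (fun l => Real.sin (l * a)) 0 l :=
    (hasDerivAt_const l (0 : ℝ)).congr_of_eventuallyEq
      (eventuallyEq_of_mem (Ioo_mem_nhds hl.1 hl.2) h)
  rcases mul_eq_zero.1 (hd.unique h0) with h1 | h1
  · have := Real.sin_sq_add_cos_sq (l * a)
    rw [h l hl, h1] at this
    norm_num at this
  · exact h1

theorem sin_eq_zero_of_cos_mul_cos_eq_one {a b : ℝ} (h : Real.cos a * Real.cos b = 1) :
    Real.sin a = 0 ∧ Real.sin b = 0 := by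
  have h1 := Real.sin_sq_add_cos_sq a
  have h2 := Real.sin_sq_add_cos_sq b
  have h3 : (Real.cos a * Real.cos b) ^ 2 = 1 := by rw [h, one_pow]
  constructor <;> refine pow_eq_zero_iff two_ne_zero |>.1 ?_ <;>
    nlinarith [sq_nonneg (Real.sin a), sq_nonneg (Real.sin b), sq_nonneg (Real.cos a),
      sq_nonneg (Real.cos b), mul_pow (Real.cos a) (Real.cos b) 2,
      mul_nonneg (sq_nonneg (Real.sin a)) (sq_nonneg (Real.cos b)),
      mul_nonneg (sq_nonneg (Real.sin b)) (sq_nonneg (Real.cos a))]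

/-- Otherwise both cosines are `± 1`, hence both sines vanish, along a segment of a ray on which
`⟪η, z⟫ = ‖η‖ ‖z‖`. -/
theorem exists_cos_mul_cos_ne_one {k : ℕ} (hk : 0 < k) {Q : ℝ} (hQ : 0 < Q) {h : ℝ} {z : Space k}
    (hz : (h, z) ≠ 0) :
    ∃ η : Space k, ‖η‖ ∈ Ioo Q (2 * Q) ∧ Real.cos ⟪η, z⟫ * Real.cos (‖η‖ * h) ≠ 1 := by
  by_contra! hcon
  obtain ⟨e, he, hez⟩ : ∃ e : Space k, ‖e‖ = 1 ∧ ⟪e, z⟫ = ‖z‖ := by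
    by_cases h0 : z = 0
    · exact ⟨EuclideanSpace.single ⟨0, hk⟩ 1, by simp, by simp [h0]⟩
    · have hne : ‖z‖ ≠ 0 := norm_ne_zero_iff.2 h0
      refine ⟨‖z‖⁻¹ • z, by simp [norm_smul, hne], ?_⟩
      rw [inner_smul_left, real_inner_self_eq_norm_sq, conj_trivial]
      field_simp
  have hs : ∀ l ∈ Ioo Q (2 * Q), Real.sin (l * ‖z‖) = 0 ∧ Real.sin (l * h) = 0 := fun l hl => by
    have hl0 : 0 < l := hQ.trans hl.1
    have hn : ‖l • e‖ = l := by rw [norm_smul, he, mul_one, Real.norm_of_nonneg hl0.le]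
    have := hcon (l • e) (by rwa [hn])
    rw [hn, inner_smul_left, hez, conj_trivial] at this
    exact sin_eq_zero_of_cos_mul_cos_eq_one this
  have h1 := eq_zero_of_sin_mul_eq_zero (by linarith : Q < 2 * Q) fun l hl => (hs l hl).1
  have h2 := eq_zero_of_sin_mul_eq_zero (by linarith : Q < 2 * Q) fun l hl => (hs l hl).2
  exact hz (by rw [h2, norm_eq_zero.1 h1]; rfl)

theorem bandVariogram_pos {k : ℕ} (hk : 0 < k) (β : ℝ) {Q : ℝ} (hQ : 0 < Q) {p : ℝ × Space k}
    (hp : p ≠ 0) : 0 < bandVariogram k β Q p := by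
  obtain ⟨η₀, hη₀, hne⟩ := exists_cos_mul_cos_ne_one hk hQ (h := p.1) (z := p.2) hp
  rw [bandVariogram, setIntegral_pos_iff_support_of_nonneg_ae (Eventually.of_forall fun η =>
    mul_nonneg (one_sub_cos_mul_cos_nonneg _ _) (by positivity))
    (integrableOn_bandVariogram k β hQ p)]
  set U : Set (Space k) := {η | ‖η‖ ∈ Ioo Q (2 * Q)} ∩
    {η | Real.cos ⟪η, p.2⟫ * Real.cos (‖η‖ * p.1) ≠ 1} with hU
  have hUo : IsOpen U := (isOpen_Ioo.preimage continuous_norm).inter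
    (isOpen_ne.preimage (by fun_prop :
      Continuous fun η : Space k => Real.cos ⟪η, p.2⟫ * Real.cos (‖η‖ * p.1)))
  refine (hUo.measure_pos volume ⟨η₀, hη₀, hne⟩).trans_le (measure_mono fun η hη => ⟨?_, ?_⟩)
  · have h1 : 0 < ‖η‖ := hQ.trans hη.1.1
    exact mul_ne_zero (sub_ne_zero.2 (Ne.symm hη.2)) (Real.rpow_pos_of_pos h1 _).ne'
  · exact Ioo_subset_Icc_self hη.1

/-- The band variogram is continuous and positive, hence bounded below on the compact unit sphere
of the norm `|h| + ‖z‖`. -/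
theorem exists_le_bandVariogram {k : ℕ} (hk : 0 < k) (β : ℝ) {Q : ℝ} (hQ : 0 < Q) :
    ∃ c, 0 < c ∧ ∀ p : ℝ × Space k, |p.1| + ‖p.2‖ = 1 → c ≤ bandVariogram k β Q p := by
  set S : Set (ℝ × Space k) := {p | |p.1| + ‖p.2‖ = 1} with hS
  have hSc : IsCompact S := by
    refine (isCompact_closedBall (0 : ℝ × Space k) 1).of_isClosed_subset
      (isClosed_eq (by fun_prop) continuous_const) fun p hp => ?_
    rw [mem_closedBall_zero_iff, Prod.norm_def, Real.norm_eq_abs]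
    have hp' : |p.1| + ‖p.2‖ = 1 := hp
    exact max_le (by linarith [norm_nonneg p.2]) (by linarith [abs_nonneg p.1])
  obtain ⟨p₀, hp₀, hmin⟩ := hSc.exists_isMinOn ⟨((1 : ℝ), (0 : Space k)), by simp [hS]⟩
    (continuous_bandVariogram k β hQ).continuousOn
  refine ⟨_, bandVariogram_pos hk β hQ (p := p₀) ?_, fun p hp => hmin hp⟩
  rintro rfl
  simp [hS] at hp₀

open scoped Pointwise in
/-- Lower bound for the squared `L²` distance of the symbols of two points at most `R` apart:
after division of the frequencies by the size `ρ` of the increment, a fixed band of frequencies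
already contributes `ρ^(2 - β)` times the band variogram of a normalized increment. -/
theorem HypBeta.le_lintegral_increment {k : ℕ} {μ : Measure (Space k)} {β : ℝ}
    (h : HypBeta μ β) {t₀ R : ℝ} (ht₀ : 0 < t₀) :
    ∃ c, 0 < c ∧ ∀ (t s : ℝ) (x y : Space k), t₀ ≤ t → t₀ ≤ s → |t - s| + ‖x - y‖ ≤ R →
      ENNReal.ofReal (c * (|t - s| + ‖x - y‖) ^ (2 - β)) ≤
        ∫⁻ p, ‖waveMultiplier t x p.1 p.2 - waveMultiplier s y p.1 p.2‖ₑ ^ 2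
          ∂spaceTimeMeasure μ := by
  have := h.sFinite
  -- for `ρ ≤ R`, a frequency of norm at least `Q / ρ` has half a period in `[0, t₀]`
  set Q := max 1 (Real.pi * R / t₀) with hQdef
  have hQ : 0 < Q := one_pos.trans_le (le_max_left _ _)
  obtain ⟨c, hc, hcle⟩ := exists_le_bandVariogram h.pos_dim β hQ
  refine ⟨t₀ / 2 * c, by positivity, fun t s x y ht hs hR => ?_⟩
  rcases (show 0 ≤ |t - s| + ‖x - y‖ by positivity).eq_or_lt with h0 | hρ
  · rw [← h0, Real.zero_rpow (by linarith [h.lt_two])]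
    simp
  set ρ := |t - s| + ‖x - y‖ with hρdef
  set f : Space k → ℝ := fun ξ => ‖ξ‖ ^ (β - k - 2) *
    (t₀ / 2 * (1 - Real.cos ⟪ξ, x - y⟫ * Real.cos (‖ξ‖ * (t - s)))) with hf
  have hf0 : ∀ ξ, 0 ≤ f ξ := fun ξ =>
    mul_nonneg (by positivity) (mul_nonneg (by positivity) (one_sub_cos_mul_cos_nonneg _ _))
  set A : Set (Space k) := annulus k (Q / ρ) with hA
  have hAm : MeasurableSet A := (isCompact_annulus k (Q / ρ)).measurableSet
  have hAs : ρ⁻¹ • annulus k Q = A := by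
    ext ξ
    rw [mem_inv_smul_set_iff₀ hρ.ne', hA, annulus, annulus, mem_ofPred_eq, mem_ofPred_eq, norm_smul,
      Real.norm_of_nonneg hρ.le, mem_Icc, mem_Icc, div_le_iff₀ hρ, mul_div_assoc', le_div_iff₀ hρ,
      mul_comm ρ]
  have hfint : IntegrableOn f A :=
    (integrableOn_norm_rpow_annulus k _ (div_pos hQ hρ)).mul_continuousOn (by fun_prop)
      (isCompact_annulus k _)
  -- the change of variables `ξ = η / ρ` normalizes the increment
  have hscale : ∫ ξ in A, f ξ =
      t₀ / 2 * bandVariogram k β Q (ρ⁻¹ * (t - s), ρ⁻¹ • (x - y)) * ρ ^ (2 - β) := by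
    have e := Measure.setIntegral_comp_smul_of_pos volume f (annulus k Q) (inv_pos.2 hρ)
    have e' : ∀ η : Space k, f (ρ⁻¹ • η) = (t₀ / 2 * ρ ^ (k + 2 - β)) *
        ((1 - Real.cos ⟪η, ρ⁻¹ • (x - y)⟫ * Real.cos (‖η‖ * (ρ⁻¹ * (t - s)))) *
          ‖η‖ ^ (β - k - 2)) := fun η => by
      have h1 : ρ⁻¹ ^ (β - k - 2) = ρ ^ (k + 2 - β) := by
        rw [Real.inv_rpow hρ.le, ← Real.rpow_neg hρ.le]
        congr 1
        ring
      have h2 : ρ⁻¹ * ‖η‖ * (t - s) = ‖η‖ * (ρ⁻¹ * (t - s)) := by ring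
      simp only [hf]
      rw [norm_smul, Real.norm_of_nonneg (inv_pos.2 hρ).le,
        Real.mul_rpow (inv_pos.2 hρ).le (norm_nonneg _), h1, inner_smul_left, inner_smul_right,
        conj_trivial, h2]
      ring
    simp only [e'] at e
    rw [integral_const_mul, hAs, finrank_euclideanSpace_fin, smul_eq_mul, inv_pow, inv_inv] at e
    have e3 : ρ ^ (k + 2 - β) = ρ ^ k * ρ ^ (2 - β) := by
      rw [← Real.rpow_natCast, ← Real.rpow_add hρ]
      congr 1
      ring
    have hne : ρ ^ k ≠ 0 := by positivity
    refine mul_left_cancel₀ hne (e.symm.trans ?_)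
    rw [e3, bandVariogram]
    ring
  have hunit : |ρ⁻¹ * (t - s)| + ‖ρ⁻¹ • (x - y)‖ = 1 := by
    rw [abs_mul, norm_smul, Real.norm_of_nonneg (inv_pos.2 hρ).le, abs_of_pos (inv_pos.2 hρ),
      ← mul_add, ← hρdef, inv_mul_cancel₀ hρ.ne']
  have hmeas := measurable_enorm_waveMultiplier_sub t s x y
  calc ENNReal.ofReal (t₀ / 2 * c * ρ ^ (2 - β)) ≤ ENNReal.ofReal (∫ ξ in A, f ξ) := by
        rw [hscale]
        have := hcle (ρ⁻¹ * (t - s), ρ⁻¹ • (x - y)) hunit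
        gcongr
    _ = ∫⁻ ξ in A, ENNReal.ofReal (f ξ) :=
        ofReal_integral_eq_lintegral_ofReal hfint (Eventually.of_forall hf0)
    _ ≤ ∫⁻ ξ in A, ENNReal.ofReal (‖ξ‖ ^ (-(k : ℝ) + β)) *
          ∫⁻ r in Ioi (0 : ℝ), ‖waveMultiplier t x r ξ - waveMultiplier s y r ξ‖ₑ ^ 2 := by
        refine setLIntegral_mono_ae' hAm (Eventually.of_forall fun ξ hξ => ?_)
        have hn : 0 < ‖ξ‖ := (div_pos hQ hρ).trans_le hξ.1
        have hπ : Real.pi ≤ t₀ * ‖ξ‖ := by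
          have h1 : Real.pi * R / t₀ ≤ Q := le_max_right _ _
          have h2 : Q ≤ ‖ξ‖ * ρ := (div_le_iff₀ hρ).1 hξ.1
          rw [div_le_iff₀ ht₀] at h1
          have h3 : Real.pi * ρ ≤ t₀ * ‖ξ‖ * ρ := by
            nlinarith [mul_le_mul_of_nonneg_left hR Real.pi_pos.le]
          exact le_of_mul_le_mul_right h3 hρ
        refine le_trans (le_of_eq ?_) (mul_le_mul_right (lintegral_time_ge ht₀ ht hs x y hπ) _)
        rw [← ENNReal.ofReal_mul (by positivity)]
        congr 1
        have e1 : ‖ξ‖ ^ (-(k : ℝ) + β) = ‖ξ‖ ^ (β - k - 2) * ‖ξ‖ ^ 2 := by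
          rw [← Real.rpow_natCast, ← Real.rpow_add hn]
          congr 1
          push_cast
          ring
        rw [e1, hf]
        field_simp
    _ ≤ ∫⁻ ξ, ENNReal.ofReal (‖ξ‖ ^ (-(k : ℝ) + β)) *
          ∫⁻ r in Ioi (0 : ℝ), ‖waveMultiplier t x r ξ - waveMultiplier s y r ξ‖ₑ ^ 2 :=
        setLIntegral_le_lintegral _ _
    _ = ∫⁻ ξ, (∫⁻ r in Ioi (0 : ℝ),
          ‖waveMultiplier t x r ξ - waveMultiplier s y r ξ‖ₑ ^ 2) ∂μ := by
        rw [h.lintegral_eq]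
        exact hmeas.lintegral_prod_left'
    _ = _ := by
        rw [lintegral_prod_symm _ hmeas.aemeasurable]

/-! ### Two-sided bounds for the second moments -/

theorem norm_sub_le_of_mem_cube {k : ℕ} {M : ℝ} {x y : Space k}
    (hx : ∀ i, x i ∈ Icc (-M) M) (hy : ∀ i, y i ∈ Icc (-M) M) :
    ‖x - y‖ ≤ √(k * (2 * M) ^ 2) := by
  refine Real.le_sqrt_of_sq_le ?_
  rw [EuclideanSpace.norm_sq_eq]
  refine (Finset.sum_le_card_nsmul _ _ ((2 * M) ^ 2) fun i _ => ?_).trans_eq (by simp)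
  rw [PiLp.sub_apply, Real.norm_eq_abs]
  have h : |x i - y i| ≤ 2 * M :=
    abs_le.2 ⟨by linarith [(hx i).1, (hy i).2], by linarith [(hx i).2, (hy i).1]⟩
  gcongr

theorem sum_sq_entries_pos {d : ℕ} (hd : 0 < d) {σ : Matrix (Fin d) (Fin d) ℝ} (hσ : IsUnit σ) :
    0 < ∑ i, ∑ j, σ i j ^ 2 := by
  have : Nonempty (Fin d) := ⟨⟨0, hd⟩⟩
  obtain ⟨i, j, hij⟩ : ∃ i j, σ i j ≠ 0 := by
    by_contra! h
    exact hσ.ne_zero (Matrix.ext h)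
  refine Finset.sum_pos' (fun i _ => Finset.sum_nonneg fun j _ => sq_nonneg _)
    ⟨i, Finset.mem_univ i, ?_⟩
  exact Finset.sum_pos' (fun j _ => sq_nonneg _) ⟨j, Finset.mem_univ j, by positivity⟩

theorem sqrt_mul_rpow (C : ℝ) {ρ : ℝ} (hρ : 0 ≤ ρ) (a : ℝ) (hC : 0 ≤ C) :
    √(C * ρ ^ a) = √C * ρ ^ (a / 2) := by
  rw [Real.sqrt_mul hC, Real.sqrt_eq_rpow (ρ ^ a), ← Real.rpow_mul hρ, mul_one_div]

end StochWave

theorem mainTheorem7 {k d : ℕ} (hd : 0 < d) (β : ℝ)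
    (Γ μ : MeasureTheory.Measure (StochWave.Space k))
    (hΓ : StochWave.IsSpectralMeasure Γ μ) (hβ : StochWave.HypBeta μ β)
    (σ : Matrix (Fin d) (Fin d) ℝ) (hσ : IsUnit σ)
    (t₀ T M : ℝ) (ht₀ : 0 < t₀) (hM : 0 < M) :
    ∃ C₁ C₂ : ℝ, 0 < C₁ ∧ 0 < C₂ ∧
      ∀ (Ω : Type*) [MeasurableSpace Ω] (P : MeasureTheory.Measure Ω)
        [MeasureTheory.IsProbabilityMeasure P]
        (F : Fin d → StochWave.Test k → Ω → ℝ) (_ : StochWave.IsHomogeneousNoise P Γ F)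
        (u : ℝ → StochWave.Space k → Ω → EuclideanSpace ℝ (Fin d))
        (_ : StochWave.IsWaveSolution P μ F σ T u),
        ∀ t ∈ Set.Icc t₀ T, ∀ s ∈ Set.Icc t₀ T, ∀ x y : StochWave.Space k,
          (∀ i, x i ∈ Set.Icc (-M) M) → (∀ i, y i ∈ Set.Icc (-M) M) →
          MeasureTheory.Integrable (fun ω => ‖u t x ω - u s y ω‖ ^ 2) P ∧
          C₁ * (|t - s| + ‖x - y‖) ^ (2 - β) ≤ ∫ ω, ‖u t x ω - u s y ω‖ ^ 2 ∂P ∧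
          ∫ ω, ‖u t x ω - u s y ω‖ ^ 2 ∂P ≤ C₂ * (|t - s| + ‖x - y‖) ^ (2 - β) ∧
          √C₁ * (|t - s| + ‖x - y‖) ^ ((2 - β) / 2)
            ≤ StochWave.canonicalMetric P u t x s y ∧
          StochWave.canonicalMetric P u t x s y
            ≤ √C₂ * (|t - s| + ‖x - y‖) ^ ((2 - β) / 2) := by
  have := hβ.sFinite
  have hσ0 := StochWave.sum_sq_entries_pos hd hσ
  obtain ⟨c, hc, hlow⟩ :=
    hβ.le_lintegral_increment (R := |T| + √(k * (2 * M) ^ 2)) ht₀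
  set I := ∫ η : StochWave.Space k, StochWave.radialBound k β ‖η‖ with hI
  have hI0 : 0 ≤ I :=
    integral_nonneg fun η => StochWave.radialBound_nonneg k β (norm_nonneg _)
  set C₂ := (∑ i, ∑ j, σ i j ^ 2) * (|T| * I + 1) with hC₂
  have hC₁0 : 0 < (∑ i, ∑ j, σ i j ^ 2) * c := by positivity
  have hC₂0 : 0 < C₂ := by positivity
  refine ⟨(∑ i, ∑ j, σ i j ^ 2) * c, C₂, hC₁0, hC₂0, ?_⟩
  intro Ω _ P _ F hF u hu t ht s hs x y hx hy
  have ht0 : 0 ≤ t := ht₀.le.trans ht.1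
  have hs0 : 0 ≤ s := ht₀.le.trans hs.1
  have hT : 0 ≤ T := ht0.trans ht.2
  obtain ⟨hint, hval⟩ := hu.integral_norm_sub_sq hβ.absolutelyContinuous hF hΓ ⟨ht0, ht.2⟩
    ⟨hs0, hs.2⟩ x y (hβ.memLp_waveMultiplier ht0 x) (hβ.memLp_waveMultiplier hs0 y)
  have hup := hβ.lintegral_increment_le hT ht.2 hs.2 x y
  have hR : |t - s| + ‖x - y‖ ≤ |T| + √(k * (2 * M) ^ 2) := by
    refine add_le_add ?_ (StochWave.norm_sub_le_of_mem_cube hx hy)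
    rw [abs_of_nonneg hT]
    exact abs_sub_le_of_nonneg_of_le ht0 ht.2 hs0 hs.2
  have hlo := hlow t s x y ht.1 hs.1 hR
  set N := ∫⁻ p, ‖StochWave.waveMultiplier t x p.1 p.2 -
    StochWave.waveMultiplier s y p.1 p.2‖ₑ ^ 2 ∂StochWave.spaceTimeMeasure μ with hN
  set ρ := |t - s| + ‖x - y‖ with hρ
  have hρ0 : 0 ≤ ρ := by positivity
  have hNtop : N ≠ ⊤ := (hup.trans_lt ENNReal.ofReal_lt_top).ne
  have h1 : c * ρ ^ (2 - β) ≤ N.toReal := (ENNReal.ofReal_le_iff_le_toReal hNtop).1 hlo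
  have h2 : N.toReal ≤ T * I * ρ ^ (2 - β) := ENNReal.toReal_le_of_le_ofReal (by positivity) hup
  have hE1 : (∑ i, ∑ j, σ i j ^ 2) * c * ρ ^ (2 - β) ≤ ∫ ω, ‖u t x ω - u s y ω‖ ^ 2 ∂P := by
    rw [hval, mul_assoc]
    gcongr
  have hE2 : ∫ ω, ‖u t x ω - u s y ω‖ ^ 2 ∂P ≤ C₂ * ρ ^ (2 - β) := by
    rw [hval, hC₂, mul_assoc]
    gcongr
    refine h2.trans ?_
    rw [abs_of_nonneg hT]
    gcongr
    linarith
  refine ⟨hint, hE1, hE2, ?_, ?_⟩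
  · rw [← StochWave.sqrt_mul_rpow _ hρ0 _ hC₁0.le]
    exact Real.sqrt_le_sqrt hE1
  · rw [← StochWave.sqrt_mul_rpow _ hρ0 _ hC₂0.le]
    exact Real.sqrt_le_sqrt hE2
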